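/- Let $f$ be a transcendental meromorphic function in the complex plane $\mathbb{C}$ (that is, $f$ is meromorphic in $\mathbb{C}$ and is not a rational function), and let $k, l, n \ge 2$ be integers. Then the function $f^l (f^{(k)})^n$ assumes every finite nonzero value infinitely often: for every $a \in \mathbb{C}\setminus\{0\}$ the equation $f(z)^l \bigl(f^{(k)}(z)\bigr)^n = a$ has infinitely many solutions $z \in \mathbb{C}$. Equivalently, the only possible finite Picard exceptional value of $f^l (f^{(k)})^n$ is zero, where $a\in\mathbb{C}$ is called a Picard exceptional value of a meromorphic function $g$ in $\mathbb{C}$ if $g$ has only finitely many $a$-points in $\mathbb{C}$. -/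

import Mathlib

open Filter Topology

namespace ValueDistribution

/-- A function `f : ℂ → ℂ` represents a rational function: it agrees with a quotient of two
polynomials off a closed discrete subset of the plane. (The values of a Mathlib `Meromorphic`
function on a closed discrete set are irrelevant to the meromorphic function it represents.) -/
def IsRational (f : ℂ → ℂ) : Prop :=
  ∃ p q : Polynomial ℂ, q ≠ 0 ∧ f =ᶠ[codiscrete ℂ] fun z => p.eval z / q.eval z

/-- A transcendental meromorphic function in the plane: meromorphic in `ℂ` and not rational. -/
structure IsTranscendentalMeromorphic (f : ℂ → ℂ) : Prop where
  meromorphic : Meromorphic f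
  not_isRational : ¬ IsRational f

/-- `z` is an `a`-point of the meromorphic function `g`, for `a ∈ ℂ ∪ {∞}`: the value at `z` of
the continuous extension of `g` to a map from `ℂ` to the Riemann sphere is `a`. -/
def IsPointOf (g : ℂ → ℂ) (a : OnePoint ℂ) (z : ℂ) : Prop :=
  Tendsto (fun w => (g w : OnePoint ℂ)) (𝓝[≠] z) (𝓝 a)

/-- `g` assumes the value `a ∈ ℂ ∪ {∞}` infinitely often. -/
def AssumesInfinitelyOften (g : ℂ → ℂ) (a : OnePoint ℂ) : Prop :=
  {z : ℂ | IsPointOf g a z}.Infinite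

/-- `a ∈ ℂ ∪ {∞}` is a Picard exceptional value of `g`: `g` has only finitely many `a`-points
in the plane. -/
def IsPicardExceptionalValue (g : ℂ → ℂ) (a : OnePoint ℂ) : Prop :=
  {z : ℂ | IsPointOf g a z}.Finite

/-- The differential monomial `f ^ l * (f^{(k)}) ^ n`. -/
noncomputable def diffMonomial (f : ℂ → ℂ) (k l n : ℕ) : ℂ → ℂ :=
  fun z => f z ^ l * iteratedDeriv k f z ^ n

end ValueDistribution

/-! The argument is Nevanlinna theory. Write F = f^l (f^{(k)})^n and suppose that F takes the value
a ≠ 0 only finitely often. The exponents l, n ≥ 2 make every zero of F multiple and every pole of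
multiplicity at least three. Consider φ = F'/(F(F - a)), which is a⁻¹ times the difference of the
logarithmic derivatives of F - a and F, so that its proximity function is a small error term. Poles
of F become zeros of φ, while zeros and a-points of F give at most simple poles. Comparing
multiplicities and using T(1/φ) = T(φ) + O(1) gives T(r, F) ≤ 6 N(r, 1/(F - a)) + error
(`exists_characteristic_le_logCounting`).

Next, f^{-(l+n)} = F⁻¹ (f^{(k)}/f)^n, and every zero of f is a zero of F of at least the same
multiplicity, so T(r, f) ≤ T(r, F) + error (`exists_characteristic_le_characteristic_diffMonomial`).
Finitely many a-points have a counting function O(log r). Hence T(r, f) is bounded by its own error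
term, and Borel's growth lemma gives T(r, f) = O(log r) for arbitrarily large r. Such a function is
rational (`isRational_of_frequently_characteristic_le`), contrary to transcendence.

The analytic core is the lemma on the logarithmic derivative, `exists_proximity_logDeriv_le`. Its
error term involves two radii r < R instead of an exceptional set; R is chosen only at the end, in
Borel's lemma. -/

namespace ValueDistribution

/-! ### Uniform circle means of ‖z - u‖ ^ (-1/2) -/

open MeasureTheory Real

/-- The distance between a point of a circle about the origin and a point of the positive real
axis is bounded from below by a multiple of the angle. -/
lemma mul_abs_div_pi_le_norm_circleMap_sub {r s ψ : ℝ} (hr : 0 ≤ r) (hs : 0 ≤ s) (hψ : |ψ| ≤ π) :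
    r * |ψ| / π ≤ ‖circleMap 0 r ψ - s‖ := by
  have hsq : ‖circleMap 0 r ψ - s‖ ^ 2 = (r * cos ψ - s) ^ 2 + (r * sin ψ) ^ 2 := by
    rw [Complex.sq_norm, Complex.normSq_apply]
    simp [circleMap, Complex.exp_ofReal_mul_I_re, Complex.exp_ofReal_mul_I_im]
    ring
  apply le_of_sq_le_sq _ (norm_nonneg _)
  rw [hsq]
  have hp := Real.pi_pos
  -- For acute angles the imaginary part suffices, by Jordan's inequality. Otherwise cos ψ ≤ 0 and
  -- the distance is at least r.
  rcases le_or_gt |ψ| (π / 2) with h | h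
  · have h1 := Real.mul_abs_le_abs_sin h
    have h2 : r * |ψ| / π ≤ |r * sin ψ| := by
      rw [abs_mul, abs_of_nonneg hr]
      have : r * |ψ| / π ≤ r * (2 / π * |ψ|) := by
        have : 0 ≤ r * |ψ| / π := by positivity
        calc r * |ψ| / π ≤ r * |ψ| / π + r * |ψ| / π := by linarith
          _ = _ := by ring
      exact this.trans (by gcongr)
    calc (r * |ψ| / π) ^ 2 ≤ |r * sin ψ| ^ 2 := by gcongr
      _ = (r * sin ψ) ^ 2 := sq_abs _
      _ ≤ _ := by nlinarith [sq_nonneg (r * cos ψ - s)]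
  · have hc : cos ψ ≤ 0 := by
      rw [← cos_abs]
      exact cos_nonpos_of_pi_div_two_le_of_le h.le (by linarith)
    have h2 : r * |ψ| / π ≤ r := by
      rw [div_le_iff₀ hp]; gcongr
    calc (r * |ψ| / π) ^ 2 ≤ r ^ 2 := by gcongr
      _ ≤ _ := by
        nlinarith [sin_sq_add_cos_sq ψ, mul_nonneg (mul_nonneg hr hs) (neg_nonneg.2 hc)]

/-- The exponent -1/2 is integrable at the singularity. This function is the common majorant for all
centres u and radii r ≥ 1. -/
lemma intervalIntegrable_inv_sqrt_abs_sub_pi :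
    IntervalIntegrable (fun θ : ℝ ↦ (√(|θ - π| / π))⁻¹) volume 0 (2 * π) := by
  have hp := Real.pi_pos
  have key : IntervalIntegrable (fun θ : ℝ ↦ (θ ^ (-(1 / 2) : ℝ)) * √π) volume 0 π :=
    (intervalIntegral.intervalIntegrable_rpow' (by norm_num)).mul_const _
  have hpt : ∀ x : ℝ, 0 ≤ x → (√(x / π))⁻¹ = x ^ (-(1 / 2) : ℝ) * √π := by
    intro x hx
    rw [Real.sqrt_div hx, inv_div, rpow_neg hx, ← Real.sqrt_eq_rpow, div_eq_mul_inv, mul_comm]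
  apply IntervalIntegrable.trans (b := π)
  · have := key.comp_sub_left π
    simp only [sub_zero, sub_self] at this
    refine this.symm.congr ?_
    intro θ hθ
    rw [Set.uIoc_of_le hp.le] at hθ
    simp only
    rw [abs_sub_comm, abs_of_nonneg (by linarith [hθ.2]), hpt _ (by linarith [hθ.2])]
  · have := key.comp_sub_right π
    simp only [zero_add, ← two_mul] at this
    refine this.congr ?_
    intro θ hθ
    rw [Set.uIoc_of_le (by linarith)] at hθ
    simp only
    rw [abs_of_nonneg (by linarith [hθ.1]), hpt _ (by linarith [hθ.1])]

/-- A rotation moves u to the positive real axis; the shift by π places the closest point at the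
middle of [0, 2π], so that the angle θ - π stays in [-π, π]. -/
lemma circleMap_sub_eq (r : ℝ) (u : ℂ) (θ : ℝ) :
    ‖circleMap 0 r (θ + (Complex.arg u - π)) - u‖ = ‖circleMap 0 r (θ - π) - (‖u‖ : ℝ)‖ := by
  have hu : u = (‖u‖ : ℝ) * Complex.exp (Complex.arg u * Complex.I) :=
    (Complex.norm_mul_exp_arg_mul_I u).symm
  have : circleMap 0 r (θ + (Complex.arg u - π)) - u
      = Complex.exp (Complex.arg u * Complex.I) * (circleMap 0 r (θ - π) - (‖u‖ : ℝ)) := by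
    conv_lhs => rhs; rw [hu]
    simp only [circleMap, zero_add]
    rw [mul_sub, mul_comm (Complex.exp _) ((‖u‖ : ℝ) : ℂ)]
    congr 1
    rw [mul_left_comm, ← Complex.exp_add]
    congr 2
    push_cast
    ring
  rw [this, norm_mul, Complex.norm_exp_ofReal_mul_I, one_mul]

/-- The circle averages of `‖z - u‖ ^ (-1/2)` are bounded uniformly in the centre `u` and the
radius `r ≥ 1`. -/
lemma exists_circleAverage_inv_sqrt_norm_sub_le :
    ∃ C : ℝ, 0 ≤ C ∧ ∀ r : ℝ, 1 ≤ r → ∀ u : ℂ,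
      CircleIntegrable (fun z ↦ (√‖z - u‖)⁻¹) 0 r ∧
      circleAverage (fun z ↦ (√‖z - u‖)⁻¹) 0 r ≤ C := by
  have hp := Real.pi_pos
  refine ⟨(2 * π)⁻¹ * ∫ θ in (0)..(2 * π), (√(|θ - π| / π))⁻¹, ?_, ?_⟩
  · apply mul_nonneg (by positivity)
    exact intervalIntegral.integral_nonneg (by positivity) (fun θ _ ↦ by positivity)
  intro r hr u
  set η := Complex.arg u - π with hη
  have hmeas : Measurable (fun θ : ℝ ↦ (√‖circleMap 0 r θ - u‖)⁻¹) := by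
    have := (continuous_circleMap 0 r).measurable
    fun_prop
  have hbound : ∀ θ ∈ Set.Ioc 0 (2 * π), θ ≠ π →
      (√‖circleMap 0 r (θ + η) - u‖)⁻¹ ≤ (√(|θ - π| / π))⁻¹ := by
    intro θ hθ hne
    rw [hη, circleMap_sub_eq]
    have h1 := mul_abs_div_pi_le_norm_circleMap_sub (r := r) (s := ‖u‖) (ψ := θ - π)
      (by linarith) (norm_nonneg u) (by rw [abs_le]; constructor <;> linarith [hθ.1, hθ.2])
    have h3 : 0 < |θ - π| := abs_pos.2 (sub_ne_zero.2 hne)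
    have h2 : |θ - π| / π ≤ r * |θ - π| / π := by
      gcongr
      nlinarith
    have h4 : 0 < |θ - π| / π := by positivity
    have h5 : 0 < √(|θ - π| / π) := Real.sqrt_pos.2 h4
    gcongr
    exact h2.trans h1
  have hae : ∀ᵐ θ ∂(volume.restrict (Set.Ioc 0 (2 * π))),
      (√‖circleMap 0 r (θ + η) - u‖)⁻¹ ≤ (√(|θ - π| / π))⁻¹ := by
    rw [ae_restrict_iff' measurableSet_Ioc]
    have : ∀ᵐ θ : ℝ, θ ≠ π := by simp [ae_iff]
    filter_upwards [this] with θ h1 h2 using hbound θ h2 h1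
  have hint : IntervalIntegrable (fun θ ↦ (√‖circleMap 0 r (θ + η) - u‖)⁻¹) volume 0 (2 * π) := by
    refine intervalIntegrable_inv_sqrt_abs_sub_pi.mono_fun ?_ ?_
    · exact (hmeas.comp (measurable_id.add_const η)).aestronglyMeasurable
    · rw [Set.uIoc_of_le (by positivity)]
      filter_upwards [hae] with θ h
      rw [Real.norm_of_nonneg (by positivity), Real.norm_of_nonneg (by positivity)]
      exact h
  have hper : Function.Periodic (fun θ : ℝ ↦ (√‖circleMap 0 r θ - u‖)⁻¹) (2 * π) := by
    intro θ
    simp only [(periodic_circleMap 0 r) θ]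
  constructor
  · rw [circleIntegrable_def]
    have h2 := hint.comp_sub_right η
    simp only [sub_add_cancel, zero_add] at h2
    rw [add_comm] at h2
    exact hper.intervalIntegrable (by positivity) h2 0 (2 * π)
  · rw [circleAverage_eq_integral_add η, smul_eq_mul]
    gcongr
    apply intervalIntegral.integral_mono_ae_restrict (by positivity) hint
      intervalIntegrable_inv_sqrt_abs_sub_pi
    rw [← restrict_Ioc_eq_restrict_Icc]
    exact hae

end ValueDistribution

/-! ### Logarithmic derivatives of zero-free holomorphic functions -/

namespace ValueDistribution

open MeasureTheory Real Metric

/-- The values of a harmonic function in a disk are controlled by its mean absolute value on the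
boundary circle. -/
lemma abs_le_mul_circleAverage_abs_of_harmonicOnNhd {u : ℂ → ℝ} {ρ : ℝ}
    (hu : InnerProductSpace.HarmonicOnNhd u (closedBall 0 ρ)) {w : ℂ} (hw : w ∈ ball (0 : ℂ) ρ) :
    |u w| ≤ (ρ + ‖w‖) / (ρ - ‖w‖) * circleAverage |u| 0 ρ := by
  have hw' : ‖w‖ < ρ := by simpa using hw
  have hρ : 0 < ρ := (norm_nonneg w).trans_lt hw'
  have hcont : ContinuousOn u (sphere 0 |ρ|) := by
    rw [abs_of_pos hρ]
    exact fun z hz ↦ (hu z (sphere_subset_closedBall hz)).1.continuousAt.continuousWithinAt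
  have hK := continuousOn_herglotzRieszKernel_sphere hw
  have hKu : ContinuousOn ((Complex.re ∘ herglotzRieszKernel 0 w) • u) (sphere 0 |ρ|) :=
    (Complex.continuous_re.comp_continuousOn hK).smul hcont
  -- Poisson's formula; the factor in the claim is Harnack's upper bound for the kernel.
  rw [← hu.circleAverage_re_herglotzRieszKernel_smul hw]
  refine abs_circleAverage_le_circleAverage_abs.trans ?_
  rw [← smul_eq_mul, ← circleAverage_smul]
  apply circleAverage_mono hKu.abs.circleIntegrable' 
  · exact (hcont.abs.const_smul _).circleIntegrable'
  intro z hz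
  rw [abs_of_pos hρ] at hz
  have h1 := re_herglotzRieszKernel_le hz hw
  have h2 := le_re_herglotzRieszKernel hz hw
  rw [sub_zero w] at h1 h2
  have h3 : 0 ≤ (ρ - ‖w‖) / (ρ + ‖w‖) := div_nonneg (by linarith) (by positivity)
  simp only [Pi.abs_apply, Pi.smul_apply', Pi.smul_apply, Function.comp_apply, smul_eq_mul, abs_mul,
    herglotzRieszKernel_def, sub_zero] at *
  rw [abs_of_nonneg (h3.trans h2)]
  gcongr

/-- A zero-free holomorphic function on a disk has a holomorphic logarithm. -/
lemma exists_exp_eq_on_ball {g : ℂ → ℂ} {z : ℂ} {s : ℝ} (hs : 0 < s)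
    (hg : AnalyticOnNhd ℂ g (ball z s)) (hg0 : ∀ w ∈ ball z s, g w ≠ 0) :
    ∃ h : ℂ → ℂ, (∀ w ∈ ball z s, HasDerivAt h (logDeriv g w) w) ∧
      ∀ w ∈ ball z s, Complex.exp (h w) = g w := by
  have hd : DifferentiableOn ℂ (logDeriv g) (ball z s) :=
    (hg.deriv.differentiableOn).div hg.differentiableOn hg0
  obtain ⟨h, hz, hh⟩ := hd.isExactOn_ball.with_val_at z (Complex.log (g z))
  refine ⟨h, hh, ?_⟩
  have hder : ∀ w ∈ ball z s, HasDerivAt (fun w ↦ Complex.exp (-h w) * g w) 0 w := by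
    intro w hw
    have h1 := (hh w hw).neg.cexp.mul (hg w hw).differentiableAt.hasDerivAt
    convert! h1 using 1
    rw [logDeriv_apply]
    field_simp [hg0 w hw]
    ring
  have hconst : ∀ w ∈ ball z s, Complex.exp (-h w) * g w = Complex.exp (-h z) * g z := by
    intro w hw
    exact (convex_ball z s).is_const_of_fderivWithin_eq_zero (𝕜 := ℂ)
      (f := fun w ↦ Complex.exp (-h w) * g w)
      (fun w hw ↦ (hder w hw).differentiableAt.differentiableWithinAt)
      (fun w hw ↦ by
        rw [fderivWithin_of_isOpen isOpen_ball hw]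
        ext
        simp [(hder w hw).deriv]) hw (mem_ball_self hs)
  intro w hw
  have := hconst w hw
  rw [hz, Complex.exp_neg, Complex.exp_neg, Complex.exp_log (hg0 z (mem_ball_self hs)),
    inv_mul_cancel₀ (hg0 z (mem_ball_self hs))] at this
  field_simp at this
  exact this.symm

/-- The logarithmic derivative of a zero-free holomorphic function is controlled by the mean of
`|log ‖g‖|` over the boundary circle. -/
lemma norm_logDeriv_le_of_ne_zero {g : ℂ → ℂ} {ρ r : ℝ}
    (hg : AnalyticOnNhd ℂ g (closedBall 0 ρ)) (hg0 : ∀ w ∈ closedBall (0 : ℂ) ρ, g w ≠ 0)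
    {z : ℂ} (hz : ‖z‖ ≤ r) (hr : r < ρ) :
    ‖logDeriv g z‖ ≤ 64 * ρ * (circleAverage (fun w ↦ |log ‖g w‖|) 0 ρ + 1) / (ρ - r) ^ 2 := by
  have hρ : 0 < ρ := (norm_nonneg z).trans_lt (hz.trans_lt hr)
  set M := circleAverage (fun w ↦ |log ‖g w‖|) 0 ρ with hM
  have hM0 : 0 ≤ M := circleAverage_nonneg_of_nonneg (fun w _ ↦ abs_nonneg _)
  set s := (ρ - r) / 2 with hs
  have hs0 : 0 < s := by rw [hs]; linarith
  have hsub : ball z s ⊆ ball 0 ρ := by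
    apply ball_subset_ball'
    rw [dist_zero_right]
    linarith
  have hsub' := hsub.trans ball_subset_closedBall
  -- On the ball of radius s about z one has ρ + ‖w‖ ≤ 2ρ and ρ - ‖w‖ ≥ s. The summand 1 makes B
  -- positive, as Borel–Carathéodory requires.
  set B := 2 * ρ / s * (M + 1) with hB
  have hB0 : 0 < B := by positivity
  have hu : ∀ w ∈ ball z s, |log ‖g w‖| ≤ B := by
    intro w hw
    have h1 := abs_le_mul_circleAverage_abs_of_harmonicOnNhd (u := fun w ↦ log ‖g w‖)
      (fun x hx ↦ (hg x hx).harmonicAt_log_norm (hg0 x hx)) (hsub hw)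
    refine h1.trans ?_
    have h2 : ‖w‖ ≤ r + s := by
      have : ‖w - z‖ < s := by simpa [dist_eq_norm] using hw
      calc ‖w‖ = ‖(w - z) + z‖ := by simp
        _ ≤ _ := norm_add_le _ _
        _ ≤ _ := by linarith
    have h3 : circleAverage |fun w ↦ log ‖g w‖| 0 ρ = M := rfl
    rw [h3, hB]
    have : s ≤ ρ - ‖w‖ := by linarith
    gcongr
    · linarith
    · linarith
  obtain ⟨h, hh, hexp⟩ := exists_exp_eq_on_ball hs0 (hg.mono hsub') (fun w hw ↦ hg0 w (hsub' hw))
  have hre : ∀ w ∈ ball z s, (h w).re = log ‖g w‖ := by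
    intro w hw
    rw [← hexp w hw, Complex.norm_exp, Real.log_exp]
  set k : ℂ → ℂ := fun w ↦ h (z + w) - h z with hk
  have hmem : ∀ w ∈ ball (0 : ℂ) s, z + w ∈ ball z s := by
    intro w hw
    simpa [dist_eq_norm] using hw
  have hkd : ∀ w ∈ ball (0 : ℂ) s, HasDerivAt k (logDeriv g (z + w)) w := by
    intro w hw
    exact ((hh _ (hmem w hw)).comp_const_add z w).sub_const _
  have hkdiff : DifferentiableOn ℂ k (ball 0 s) :=
    fun w hw ↦ (hkd w hw).differentiableAt.differentiableWithinAt
  have hkbound : ∀ w ∈ sphere (0 : ℂ) (s / 2), ‖k w‖ ≤ 4 * B := by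
    intro w hw
    have hw1 : ‖w‖ = s / 2 := by simpa using hw
    have hws : w ∈ ball (0 : ℂ) s := by simp [hw1]; linarith
    -- The real part of k is a difference of two values of log ‖g‖, hence at most 2B. At radius s/2
    -- this gives ‖k‖ ≤ 4B, and Cauchy's estimate then gives 8B/s.
    have := Complex.borelCaratheodory_zero (M := 2 * B) (by positivity) hkdiff (fun x hx ↦ by
      have h1 := hu _ (hmem x hx)
      have h2 := hu z (mem_ball_self hs0)
      simp only [Set.mem_ofPred_eq, hk, Complex.sub_re, hre _ (hmem x hx),
        hre z (mem_ball_self hs0)]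
      linarith [le_abs_self (log ‖g (z + x)‖), neg_abs_le (log ‖g z‖)]) hs0 hws (by simp [hk])
    refine this.trans (le_of_eq ?_)
    rw [hw1]
    field_simp
    ring
  have hfin := Complex.norm_deriv_le_of_forall_mem_sphere_norm_le (c := 0) (R := s / 2) (f := k)
    (by positivity) (hkdiff.mono (by
      refine (closure_ball_subset_closedBall).trans (closedBall_subset_ball (by linarith)))
      |>.diffContOnCl) hkbound
  rw [(hkd 0 (mem_ball_self hs0)).deriv, add_zero] at hfin
  refine hfin.trans (le_of_eq ?_)
  rw [hB, hs]
  have : ρ - r ≠ 0 := by linarith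
  field_simp
  ring

end ValueDistribution

/-! ### Splitting off zeros and poles -/

namespace ValueDistribution

open MeasureTheory Real Metric MeromorphicOn

/-- This is |log x| = log⁺ x + log⁺ (1/x), averaged. -/
lemma circleAverage_abs_log_norm_eq {f : ℂ → ℂ} (hf : Meromorphic f) (ρ : ℝ) :
    circleAverage (fun z ↦ |log ‖f z‖|) 0 ρ = proximity f ⊤ ρ + proximity f⁻¹ ⊤ ρ := by
  rw [proximity_top, proximity_top, ← circleAverage_add hf.meromorphicOn.circleIntegrable_posLog_norm
    hf.inv.meromorphicOn.circleIntegrable_posLog_norm]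
  congr 1
  ext z
  simp only [Pi.add_apply, Pi.inv_apply, norm_inv, posLog_apply, log_inv]
  rcases le_total 0 (log ‖f z‖) with h | h
  · rw [abs_of_nonneg h, max_eq_right h, max_eq_left (by linarith), add_zero]
  · rw [abs_of_nonpos h, max_eq_left h, max_eq_right (by linarith), zero_add]

/-- On the circle log ‖z - u‖ ≤ log (2ρ), so its absolute value is at most 2 log (2ρ) - log ‖z - u‖;
by Jensen's formula the subtracted term has mean log ρ ≥ 0. -/
lemma circleAverage_abs_log_norm_sub_le {ρ : ℝ} (hρ : 1 ≤ ρ) {u : ℂ}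
    (hu : u ∈ closedBall (0 : ℂ) ρ) :
    circleAverage (fun z ↦ |log ‖z - u‖|) 0 ρ ≤ 2 * log (2 * ρ) := by
  have hint : CircleIntegrable (fun z ↦ log ‖z - u‖) 0 ρ := circleIntegrable_log_norm_sub_const ρ
  have hmean : circleAverage (fun z ↦ log ‖z - u‖) 0 ρ = log ρ :=
    circleAverage_log_norm_sub_const_of_mem_closedBall (by rwa [abs_of_pos (by linarith)])
  have hl : 0 ≤ log (2 * ρ) := log_nonneg (by linarith)
  have h1 : circleAverage (fun z ↦ |log ‖z - u‖|) 0 ρ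
      ≤ circleAverage (fun z ↦ 2 * log (2 * ρ) - log ‖z - u‖) 0 ρ := by
    apply circleAverage_mono hint.abs ((circleIntegrable_const _ _ _).sub hint)
    intro z hz
    rw [abs_of_pos (by linarith : (0 : ℝ) < ρ)] at hz
    have hz' : ‖z‖ = ρ := by simpa using hz
    have hu' : ‖u‖ ≤ ρ := by simpa using hu
    have h2 : log ‖z - u‖ ≤ log (2 * ρ) := by
      rcases (norm_nonneg (z - u)).eq_or_lt with h | h
      · rw [← h, log_zero]; exact hl
      · exact log_le_log h ((norm_sub_le _ _).trans (by linarith))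
    show |log ‖z - u‖| ≤ 2 * log (2 * ρ) - log ‖z - u‖
    rw [abs_le]
    constructor <;> linarith
  refine h1.trans ?_
  rw [circleAverage_fun_sub (circleIntegrable_const _ _ _) hint, circleAverage_const, hmean]
  linarith [log_nonneg hρ]

variable {U : Set ℂ} {D : Function.locallyFinsuppWithin U ℤ} {f g : ℂ → ℂ} {ρ : ℝ}

/-- After division by a rational function, the mean of `|log ‖·‖|` is controlled by the proximity
functions and the degree of the rational function. -/
lemma circleAverage_abs_log_norm_le_of_extract (hf : Meromorphic f)
    (hD : D.support.Finite) (hDρ : D.support ⊆ closedBall 0 ρ) (hρ : 1 ≤ ρ)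
    (hU : closedBall (0 : ℂ) ρ ⊆ U) (hg : AnalyticOnNhd ℂ g U) (hg0 : ∀ u : U, g u ≠ 0)
    (hfg : f =ᶠ[codiscreteWithin U] (∏ᶠ u, (· - u) ^ D u) • g) :
    circleAverage (fun z ↦ |log ‖g z‖|) 0 ρ ≤
      proximity f ⊤ ρ + proximity f⁻¹ ⊤ ρ + (∑ u ∈ hD.toFinset, |(D u : ℝ)|) * (2 * log (2 * ρ)) := by
  have hS : sphere (0 : ℂ) |ρ| ⊆ U := by
    rw [abs_of_pos (by linarith)]
    exact sphere_subset_closedBall.trans hU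
  have hlog := (extract_zeros_poles_log hg0 hfg).filter_mono (codiscreteWithin_mono hS)
  have hsum : (∑ᶠ u, fun z : ℂ ↦ (D u : ℝ) * log ‖z - u‖)
      = ∑ u ∈ hD.toFinset, fun z : ℂ ↦ (D u : ℝ) * log ‖z - u‖ := by
    apply finsum_eq_sum_of_support_subset
    intro u hu
    simp only [Set.Finite.coe_toFinset, Function.mem_support] at hu ⊢
    intro h
    simp [h] at hu
    exact hu rfl
  have hgint : CircleIntegrable (fun z ↦ |log ‖g z‖|) 0 ρ :=
    (MeromorphicOn.circleIntegrable_log_norm (hg.mono hS).meromorphicOn).abs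
  have hfint : CircleIntegrable (fun z ↦ |log ‖f z‖|) 0 ρ :=
    (MeromorphicOn.circleIntegrable_log_norm hf.meromorphicOn).abs
  have huint : ∀ u : ℂ, CircleIntegrable (fun z ↦ |(D u : ℝ)| * |log ‖z - u‖|) 0 ρ := fun u ↦
    ((circleIntegrable_log_norm_sub_const (a := u) (c := 0) ρ).abs).const_smul (a := |(D u : ℝ)|)
  have heq : (fun z ↦ |log ‖g z‖|) =ᶠ[codiscreteWithin (sphere 0 |ρ|)]
      fun z ↦ |log ‖f z‖ - ∑ u ∈ hD.toFinset, (D u : ℝ) * log ‖z - u‖| := by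
    filter_upwards [hlog] with z hz
    simp only [hsum, Pi.add_apply, Finset.sum_apply] at hz
    rw [hz, add_sub_cancel_left]
  have hint2 := (circleIntegrable_congr_codiscreteWithin heq).1 hgint
  rw [circleAverage_congr_codiscreteWithin heq (by linarith)]
  calc _ ≤ circleAverage (fun z ↦ |log ‖f z‖| + ∑ u ∈ hD.toFinset, |(D u : ℝ)| * |log ‖z - u‖|) 0 ρ := by
        apply circleAverage_mono hint2 (hfint.add (CircleIntegrable.fun_sum _ fun u _ ↦ huint u))
        intro z _
        refine (abs_sub _ _).trans (add_le_add le_rfl ?_)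
        refine (Finset.abs_sum_le_sum_abs _ _).trans (le_of_eq ?_)
        simp [abs_mul]
    _ = circleAverage (fun z ↦ |log ‖f z‖|) 0 ρ
        + ∑ u ∈ hD.toFinset, |(D u : ℝ)| * circleAverage (fun z ↦ |log ‖z - u‖|) 0 ρ := by
        rw [circleAverage_fun_add hfint (CircleIntegrable.fun_sum _ fun u _ ↦ huint u),
          circleAverage_fun_sum fun u _ ↦ huint u]
        congr 1
        refine Finset.sum_congr rfl fun u _ ↦ ?_
        exact circleAverage_fun_smul (a := |(D u : ℝ)|) (f := fun z : ℂ ↦ |log ‖z - u‖|)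
    _ ≤ _ := by
        rw [circleAverage_abs_log_norm_eq hf, Finset.sum_mul]
        gcongr with u hu
        exact circleAverage_abs_log_norm_sub_le hρ (hDρ (by simpa using hu))

/-- Pointwise bound for the logarithmic derivative of a product of a rational function and a
zero-free function. -/
lemma norm_logDeriv_le_of_extract {r K : ℝ} (hf : Meromorphic f)
    (hD : D.support.Finite) (hU : closedBall (0 : ℂ) |r| ⊆ interior U) (hg : AnalyticOnNhd ℂ g U)
    (hg0 : ∀ u : U, g u ≠ 0) (hfg : f =ᶠ[codiscreteWithin U] (∏ᶠ u, (· - u) ^ D u) • g)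
    (hK : ∀ z : ℂ, ‖z‖ = |r| → ‖logDeriv g z‖ ≤ K) :
    ∀ᶠ z in codiscreteWithin (sphere (0 : ℂ) |r|),
      ‖logDeriv f z‖ ≤ K + ∑ u ∈ hD.toFinset, |(D u : ℝ)| * ‖z - u‖⁻¹ := by
  -- An equality off a discrete set can be differentiated on an open set; the result is restricted
  -- to the circle afterwards.
  have hI : interior U ⊆ U := interior_subset
  have h1 := hfg.filter_mono (codiscreteWithin_mono hI)
  have h2 : logDeriv f =ᶠ[codiscreteWithin (interior U)] logDeriv ((∏ᶠ u, (· - u) ^ D u) • g) :=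
    
    (MeromorphicOn.deriv_eventuallyEq_codiscreteWithin hf.meromorphicOn
      ((Function.FactorizedRational.meromorphicNFOn _ _).meromorphicOn.smul
        (hg.mono hI).meromorphicOn) h1).div h1
  have h3 : logDeriv ((∏ᶠ u, (· - u) ^ D u) * g) =ᶠ[codiscreteWithin (interior U)]
      logDeriv (∏ᶠ u, (· - u) ^ D u) + logDeriv g := by
    apply MeromorphicOn.logDeriv_mul_eventuallyEq
    · exact (Function.FactorizedRational.meromorphicNFOn _ _).meromorphicOn
    · exact (hg.mono hI).meromorphicOn
    · exact fun x _ ↦ Function.FactorizedRational.meromorphicOrderAt_ne_top _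
    · intro x hx
      rw [(hg x (hI hx)).meromorphicNFAt.meromorphicOrderAt_eq_zero_iff.2 (hg0 ⟨x, hI hx⟩)]
      simp
  have h4 : logDeriv (∏ᶠ u, (fun z : ℂ ↦ z - u) ^ D u) =ᶠ[codiscreteWithin (interior U)]
      fun z ↦ ∑ᶠ u, D u • logDeriv (fun z : ℂ ↦ z - u) z := by
    apply MeromorphicOn.logDeriv_finprod_zpow_eventuallyEq hD
    · intro u
      exact fun x _ ↦ by fun_prop
    · intro u x _
      rw [meromorphicOrderAt_ne_top_iff_eventually_ne_zero (by fun_prop)]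
      rcases eq_or_ne x u with rfl | h
      · filter_upwards [self_mem_nhdsWithin] with z hz using sub_ne_zero.2 hz
      · filter_upwards [(eventually_ne_nhds h).filter_mono nhdsWithin_le_nhds] with z hz
          using sub_ne_zero.2 hz
  have hS : sphere (0 : ℂ) |r| ⊆ interior U := sphere_subset_closedBall.trans hU
  filter_upwards [h2.filter_mono (codiscreteWithin_mono hS), h3.filter_mono (codiscreteWithin_mono hS),
    h4.filter_mono (codiscreteWithin_mono hS), self_mem_codiscreteWithin (sphere (0 : ℂ) |r|)]
    with z a2 a3 a4 hz
  rw [a2, smul_eq_mul, a3, Pi.add_apply, a4, add_comm]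
  refine (norm_add_le _ _).trans (add_le_add (hK z (by simpa using hz)) ?_)
  rw [finsum_eq_sum_of_support_subset (s := hD.toFinset)]
  · refine (norm_sum_le _ _).trans (Finset.sum_le_sum fun u _ ↦ ?_)
    rw [zsmul_eq_mul, norm_mul, logDeriv_apply]
    simp
  · intro u hu
    simp only [Set.Finite.coe_toFinset, Function.mem_support] at hu ⊢
    intro h
    simp [h] at hu

end ValueDistribution

/-! ### The lemma on the logarithmic derivative -/

namespace ValueDistribution

open MeasureTheory Real Metric MeromorphicOn

lemma circleAverage_mono_codiscreteWithin {φ ψ : ℂ → ℝ} {r : ℝ} (hr : r ≠ 0)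
    (hφ : CircleIntegrable φ 0 r) (hψ : CircleIntegrable ψ 0 r)
    (h : ∀ᶠ z in codiscreteWithin (sphere (0 : ℂ) |r|), φ z ≤ ψ z) :
    circleAverage φ 0 r ≤ circleAverage ψ 0 r := by
  have heq : φ =ᶠ[codiscreteWithin (sphere (0 : ℂ) |r|)] fun z ↦ min (φ z) (ψ z) := by
    filter_upwards [h] with z hz
    rw [min_eq_left hz]
  rw [circleAverage_congr_codiscreteWithin heq hr]
  exact circleAverage_mono ((circleIntegrable_congr_codiscreteWithin heq).1 hφ) hψ
    fun z _ ↦ min_le_right _ _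

/-- A function bounded on a circle by a sum of `N` simple poles and a constant `K` has proximity
function at most logarithmic in `N` and `K`. -/
lemma exists_proximity_le_log_of_norm_le_sum :
    ∃ C : ℝ, 0 ≤ C ∧ ∀ (h : ℂ → ℂ) (D : ℂ → ℤ) (s : Finset ℂ) (K r : ℝ), Meromorphic h → 0 ≤ K →
      1 ≤ r → (∀ᶠ z in codiscreteWithin (sphere (0 : ℂ) |r|),
        ‖h z‖ ≤ K + ∑ u ∈ s, |(D u : ℝ)| * ‖z - u‖⁻¹) →
      proximity h ⊤ r ≤ 2 * log (2 + K + C * ∑ u ∈ s, |(D u : ℝ)|) := by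
  obtain ⟨C, hC, hmean⟩ := exists_circleAverage_inv_sqrt_norm_sub_le
  refine ⟨C, hC, fun h D s K r hh hK hr hbd ↦ ?_⟩
  have hr0 : r ≠ 0 := by linarith
  -- A bounds the mean of 2 + K + S. The tangent to log at A replaces Jensen's inequality: its
  -- linear part has nonpositive mean.
  set A := 2 + K + C * ∑ u ∈ s, |(D u : ℝ)| with hA
  have hA0 : 0 < A := by positivity
  set S : ℂ → ℝ := fun z ↦ ∑ u ∈ s, |(D u : ℝ)| * (√‖z - u‖)⁻¹ with hS
  have hSi : ∀ u ∈ s, CircleIntegrable (fun z ↦ |(D u : ℝ)| * (√‖z - u‖)⁻¹) 0 r := fun u _ ↦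
    ((hmean r hr u).1).const_smul (a := |(D u : ℝ)|)
  have hSint : CircleIntegrable S 0 r := CircleIntegrable.fun_sum _ hSi
  have hSavg : circleAverage S 0 r ≤ C * ∑ u ∈ s, |(D u : ℝ)| := by
    rw [hS, circleAverage_fun_sum hSi, Finset.mul_sum]
    refine Finset.sum_le_sum fun u _ ↦ ?_
    have : circleAverage (fun z ↦ |(D u : ℝ)| * (√‖z - u‖)⁻¹) 0 r
        = |(D u : ℝ)| * circleAverage (fun z ↦ (√‖z - u‖)⁻¹) 0 r :=
      circleAverage_fun_smul (a := |(D u : ℝ)|) (f := fun z : ℂ ↦ (√‖z - u‖)⁻¹)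
    rw [this, mul_comm C]
    gcongr
    exact (hmean r hr u).2
  have hSint2 : CircleIntegrable (fun z ↦ (2 / A) * S z) 0 r := hSint.const_smul (a := 2 / A)
  have hψint : CircleIntegrable (fun z ↦ 2 * log A + 2 * ((2 + K) / A - 1) + (2 / A) * S z) 0 r :=
    (circleIntegrable_const _ _ _).add hSint2
  have hpt : ∀ᶠ z in codiscreteWithin (sphere (0 : ℂ) |r|),
      log⁺ ‖h z‖ ≤ 2 * log A + 2 * ((2 + K) / A - 1) + (2 / A) * S z := by
    filter_upwards [hbd] with z hz
    have hS0 : 0 ≤ S z := Finset.sum_nonneg fun u _ ↦ by positivity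
    -- Simple poles on the circle are not integrable, but their square roots are. Integrality of D
    -- gives |D u| ≤ |D u|².
    have hsq : ∑ u ∈ s, |(D u : ℝ)| * ‖z - u‖⁻¹ ≤ S z ^ 2 := by
      refine le_trans ?_ (Finset.sum_sq_le_sq_sum_of_nonneg (s := s)
        (f := fun u ↦ |(D u : ℝ)| * (√‖z - u‖)⁻¹) (fun u _ ↦ by positivity))
      refine Finset.sum_le_sum fun u _ ↦ ?_
      rw [mul_pow, inv_pow, Real.sq_sqrt (norm_nonneg _)]
      gcongr
      have : (0 : ℤ) ≤ |D u| := abs_nonneg _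
      have h2 : |D u| ≤ |D u| ^ 2 := by nlinarith
      exact_mod_cast h2
    have hle : max 1 ‖h z‖ ≤ (2 + K + S z) ^ 2 := by
      apply max_le <;> nlinarith
    rw [posLog_eq_log_max_one (norm_nonneg _)]
    have h1 : log (max 1 ‖h z‖) ≤ 2 * log (2 + K + S z) := by
      calc _ ≤ log ((2 + K + S z) ^ 2) := log_le_log (by positivity) hle
        _ = _ := by rw [log_pow]; norm_num
    have h2 : log ((2 + K + S z) / A) ≤ (2 + K + S z) / A - 1 := log_le_sub_one_of_pos (by positivity)
    rw [log_div (by positivity) hA0.ne'] at h2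
    have h3 : (2 + K + S z) / A = (2 + K) / A + S z / A := add_div _ _ _
    have h4 : 2 / A * S z = 2 * (S z / A) := by ring
    rw [h4]
    linarith
  rw [proximity_top]
  refine (circleAverage_mono_codiscreteWithin hr0 hh.meromorphicOn.circleIntegrable_posLog_norm
    hψint hpt).trans ?_
  rw [circleAverage_fun_add (circleIntegrable_const _ _ _) hSint2,
    circleAverage_const]
  have : circleAverage (fun z ↦ 2 / A * S z) 0 r = 2 / A * circleAverage S 0 r :=
    circleAverage_fun_smul (a := 2 / A) (f := S)
  rw [this]
  have h5 : 2 / A * circleAverage S 0 r ≤ 2 / A * (C * ∑ u ∈ s, |(D u : ℝ)|) := by gcongr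
  have h6 : (2 + K) / A + (C * ∑ u ∈ s, |(D u : ℝ)|) / A = 1 := by
    rw [← add_div, ← hA, div_self hA0.ne']
  have h7 : 2 / A * (C * ∑ u ∈ s, |(D u : ℝ)|) = 2 * ((C * ∑ u ∈ s, |(D u : ℝ)|) / A) := by ring
  linarith

/-- The number of points of a divisor in a disk is controlled by the logarithmic counting
function of a larger disk. -/
lemma sum_mul_log_le_logCounting {D : Function.locallyFinsupp ℂ ℤ} (hD : 0 ≤ D) {ρ R : ℝ}
    (hρ : 1 ≤ ρ) (hR : ρ ≤ R) (s : Finset ℂ) (hs : ∀ u ∈ s, ‖u‖ ≤ ρ) :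
    (∑ u ∈ s, (D u : ℝ)) * log (R / ρ) ≤ Function.locallyFinsuppWithin.logCounting D R := by
  classical
  have hle : ∑ u ∈ s, Function.locallyFinsuppWithin.single u (D u) ≤ D := by
    rw [Function.locallyFinsuppWithin.le_def, Pi.le_def]
    intro w
    simp only [Function.locallyFinsuppWithin.coe_sum, Finset.sum_apply,
      Function.locallyFinsuppWithin.single_apply, Finset.sum_ite_eq]
    split_ifs
    · exact le_rfl
    · exact (Function.locallyFinsuppWithin.le_def.1 hD) w
  refine le_trans ?_ (Function.locallyFinsuppWithin.logCounting_le hle (hρ.trans hR))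
  rw [map_sum, Finset.sum_apply, Finset.sum_mul]
  refine Finset.sum_le_sum fun u hu ↦ ?_
  rw [Function.locallyFinsuppWithin.logCounting_single_eq_log_sub_const ((hs u hu).trans hR)]
  have h0 : (0 : ℝ) ≤ D u := by exact_mod_cast (Function.locallyFinsuppWithin.le_def.1 hD) u
  gcongr
  rw [log_div (by linarith) (by linarith)]
  -- At u = 0 the convention log 0 = 0 applies, and ρ ≥ 1 is needed.
  have : log ‖u‖ ≤ log ρ := by
    rcases (norm_nonneg u).eq_or_lt with h | h
    · rw [← h, log_zero]; exact log_nonneg hρ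
    · exact log_le_log h (hs u hu)
  linarith

/-- The growth term of the lemma on the logarithmic derivative. -/
noncomputable def logDerivError (f : ℂ → ℂ) (r R : ℝ) : ℝ :=
  1 + log (1 + characteristic f ⊤ R) + log (1 + (R - r)⁻¹) + log R

/-- The sum of the proximity functions of `f` and `f⁻¹` is controlled by the characteristic
function. -/
lemma exists_characteristic_inv_le {f : ℂ → ℂ} (hf : Meromorphic f) :
    ∃ c : ℝ, 0 ≤ c ∧ ∀ R : ℝ, characteristic f⁻¹ ⊤ R ≤ characteristic f ⊤ R + c ∧
      characteristic f ⊤ R ≤ characteristic f⁻¹ ⊤ R + c := by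
  refine ⟨max |log ‖f 0‖| |log ‖meromorphicTrailingCoeffAt f 0‖|, by positivity, fun R ↦ ?_⟩
  have := abs_le.1 (characteristic_sub_characteristic_inv_le hf (R := R))
  constructor <;> linarith [this.1, this.2]

lemma proximity_le_characteristic {f : ℂ → ℂ} {r : ℝ} (hr : 1 ≤ r) :
    proximity f ⊤ r ≤ characteristic f ⊤ r := by
  have : 0 ≤ logCounting f ⊤ r := logCounting_nonneg hr
  simp only [characteristic, Pi.add_apply]
  linarith

lemma logCounting_le_characteristic {f : ℂ → ℂ} {r : ℝ} :
    logCounting f ⊤ r ≤ characteristic f ⊤ r := by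
  have : 0 ≤ proximity f ⊤ r := proximity_nonneg r
  simp only [characteristic, Pi.add_apply]
  linarith

lemma characteristic_mono {f : ℂ → ℂ} (hf : Meromorphic f) {r R : ℝ} (hr : 1 ≤ r) (hR : r ≤ R) :
    characteristic f ⊤ r ≤ characteristic f ⊤ R :=
  characteristic_monotoneOn hf (Set.mem_Ioi.2 (by linarith)) (Set.mem_Ioi.2 (by linarith)) hR

/-- The degree of the divisor of `f` in a disk is controlled by the characteristic function. -/
lemma sum_abs_divisor_mul_log_le {f : ℂ → ℂ} {c ρ R : ℝ}
    (hc : ∀ R : ℝ, characteristic f⁻¹ ⊤ R ≤ characteristic f ⊤ R + c)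
    (hρ : 1 ≤ ρ) (hR : ρ ≤ R) (s : Finset ℂ) (hs : ∀ u ∈ s, ‖u‖ ≤ ρ) :
    (∑ u ∈ s, |(divisor f Set.univ u : ℝ)|) * log (R / ρ) ≤ 2 * characteristic f ⊤ R + c := by
  have h1 := sum_mul_log_le_logCounting (D := (divisor f Set.univ)⁺) (posPart_nonneg _) hρ hR s hs
  have h2 := sum_mul_log_le_logCounting (D := (divisor f Set.univ)⁻) (negPart_nonneg _) hρ hR s hs
  rw [← logCounting_zero, ← logCounting_inv] at h1
  rw [← logCounting_top] at h2
  have h3 : ∑ u ∈ s, |(divisor f Set.univ u : ℝ)| = (∑ u ∈ s, ((divisor f Set.univ)⁺ u : ℝ))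
      + ∑ u ∈ s, ((divisor f Set.univ)⁻ u : ℝ) := by
    rw [← Finset.sum_add_distrib]
    refine Finset.sum_congr rfl fun u _ ↦ ?_
    rw [Function.locallyFinsuppWithin.posPart_apply, Function.locallyFinsuppWithin.negPart_apply]
    have := posPart_add_negPart (divisor f Set.univ u)
    exact_mod_cast this.symm
  have h6 := logCounting_le_characteristic (f := f) (r := R)
  have h7 := logCounting_le_characteristic (f := f⁻¹) (r := R)
  rw [h3, add_mul]
  linarith [hc R]

lemma sum_abs_divisor_mul_le {f : ℂ → ℂ} {c ρ R : ℝ}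
    (hc : ∀ R : ℝ, characteristic f⁻¹ ⊤ R ≤ characteristic f ⊤ R + c)
    (hρ : 1 ≤ ρ) (hR : ρ < R) (s : Finset ℂ) (hs : ∀ u ∈ s, ‖u‖ ≤ ρ) :
    (∑ u ∈ s, |(divisor f Set.univ u : ℝ)|) * ((R - ρ) / R) ≤ 2 * characteristic f ⊤ R + c := by
  have h4 : (R - ρ) / R ≤ log (R / ρ) := by
    have := one_sub_inv_le_log_of_pos (x := R / ρ) (by apply div_pos <;> linarith)
    refine le_trans (le_of_eq ?_) this
    rw [inv_div, sub_div, div_self (by linarith)]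
  have h5 : 0 ≤ ∑ u ∈ s, |(divisor f Set.univ u : ℝ)| := Finset.sum_nonneg fun u _ ↦ abs_nonneg _
  refine le_trans ?_ (sum_abs_divisor_mul_log_le hc hρ hR.le s hs)
  gcongr

/-- Since 1 + T, 1 + δ⁻¹ and R are all at least 1, every term is absorbed into one monomial in them,
whose logarithm splits into the summands of `logDerivError`. -/
lemma logDeriv_bound_arith {c C₀ T δ R ρ n M : ℝ} (hc : 0 ≤ c) (hC₀ : 0 ≤ C₀) (hT0 : 0 ≤ T)
    (hδ0 : 0 < δ) (hρ1 : 1 ≤ ρ) (hρR : ρ = R - δ / 2) (hM0 : 0 ≤ M)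
    (hnle : n * (δ / 2 / R) ≤ 2 * T + c) (hM : M ≤ 2 * T + c + n * (2 * log (2 * ρ))) :
    2 + 64 * ρ * (M + 1) / (δ / 2) ^ 2 + C₀ * n ≤
      (2 + 256 * (3 + c + 16 * (2 + c)) + C₀ * (4 * (2 + c))) *
        ((1 + T) * (1 + δ⁻¹) ^ 3 * R ^ 3) := by
  have hρR' : ρ ≤ R := by linarith
  set X := 1 + T with hX
  set Y := 1 + δ⁻¹ with hY
  have hX1 : 1 ≤ X := by linarith
  have hδi : 0 < δ⁻¹ := inv_pos.2 hδ0
  have hY1 : 1 ≤ Y := by linarith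
  have hR1 : 1 ≤ R := by linarith
  have hYX : 1 ≤ X * Y := one_le_mul_of_one_le_of_one_le hX1 hY1
  have hXYR : 1 ≤ X * Y * R := one_le_mul_of_one_le_of_one_le hYX hR1
  have hcX : c ≤ c * X := le_mul_of_one_le_right hc hX1
  have hn' : n ≤ 4 * (2 + c) * (X * Y * R) := by
    have h2 : n = n * (δ / 2 / R) * (2 * R * δ⁻¹) := by field_simp
    rw [h2]
    calc n * (δ / 2 / R) * (2 * R * δ⁻¹) ≤ (2 * T + c) * (2 * R * δ⁻¹) := by gcongr
      _ ≤ ((2 + c) * X) * (2 * R * Y) := by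
        gcongr
        · linarith
        · linarith
      _ ≤ _ := by
        have : 0 ≤ (2 + c) * (X * Y * R) := by positivity
        linarith
  have hM' : M + 1 ≤ (3 + c + 16 * (2 + c)) * (X * Y * R ^ 2) := by
    have hl : log (2 * ρ) ≤ 2 * R := by
      have := log_le_sub_one_of_pos (x := 2 * ρ) (by linarith)
      linarith
    have hl0 : 0 ≤ log (2 * ρ) := log_nonneg (by linarith)
    have h1 : n * (2 * log (2 * ρ)) ≤ 4 * (2 + c) * (X * Y * R) * (2 * (2 * R)) := by gcongr
    have h2 : M + 1 ≤ (3 + c) * X + 4 * (2 + c) * (X * Y * R) * (2 * (2 * R)) := by linarith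
    have h3 : X ≤ X * Y * R ^ 2 := by
      rw [mul_assoc]
      exact le_mul_of_one_le_right (by linarith)
        (one_le_mul_of_one_le_of_one_le hY1 (one_le_pow₀ hR1))
    have h4 : (3 + c) * X ≤ (3 + c) * (X * Y * R ^ 2) := by gcongr
    linarith
  have hK' : 64 * ρ * (M + 1) / (δ / 2) ^ 2 ≤
      256 * (3 + c + 16 * (2 + c)) * (X * Y ^ 3 * R ^ 3) := by
    have h2 : 64 * ρ * (M + 1) / (δ / 2) ^ 2 = 256 * (ρ * (M + 1) * (δ⁻¹) ^ 2) := by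
      field_simp; ring
    rw [h2]
    calc 256 * (ρ * (M + 1) * (δ⁻¹) ^ 2)
        ≤ 256 * (R * ((3 + c + 16 * (2 + c)) * (X * Y * R ^ 2)) * Y ^ 2) := by
          gcongr
          linarith
      _ = _ := by ring
  have hbig : X * Y * R ≤ X * Y ^ 3 * R ^ 3 := by
    have h1 : Y ≤ Y ^ 3 := le_self_pow₀ hY1 (by norm_num)
    have h2 : R ≤ R ^ 3 := le_self_pow₀ hR1 (by norm_num)
    gcongr
  have h1 : C₀ * n ≤ C₀ * (4 * (2 + c)) * (X * Y ^ 3 * R ^ 3) := by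
    calc C₀ * n ≤ C₀ * (4 * (2 + c) * (X * Y * R)) := by gcongr
      _ ≤ C₀ * (4 * (2 + c) * (X * Y ^ 3 * R ^ 3)) := by gcongr
      _ = _ := by ring
  linarith

/-- The **lemma on the logarithmic derivative**. -/
theorem exists_proximity_logDeriv_le {f : ℂ → ℂ} (hf : Meromorphic f)
    (hf0 : ∀ z, meromorphicOrderAt f z ≠ ⊤) :
    ∃ C : ℝ, 0 ≤ C ∧ ∀ r R : ℝ, 1 ≤ r → r < R →
      proximity (logDeriv f) ⊤ r ≤ C * logDerivError f r R := by
  obtain ⟨C₀, hC₀, hprox⟩ := exists_proximity_le_log_of_norm_le_sum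
  obtain ⟨c, hc, hinv⟩ := exists_characteristic_inv_le hf
  set c₃ : ℝ := 2 + 256 * (3 + c + 16 * (2 + c)) + C₀ * (4 * (2 + c)) with hc₃
  have hc₃1 : 1 ≤ c₃ := by rw [hc₃]; nlinarith
  refine ⟨2 * log c₃ + 6, by have := log_nonneg hc₃1; positivity, fun r R hr hR ↦ ?_⟩
  set T := characteristic f ⊤ R with hT
  have hT0 : 0 ≤ T := characteristic_nonneg (by linarith)
  -- The gap ρ - r serves the estimate of the zero-free factor, the gap R - ρ the count of zeros and
  -- poles.
  set ρ := (r + R) / 2 with hρ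
  have hρ1 : 1 ≤ ρ := by rw [hρ]; linarith
  have hρR : ρ < R := by rw [hρ]; linarith
  have hrρ : r < ρ := by rw [hρ]; linarith
  set δ := R - r with hδ
  have hδ0 : 0 < δ := by rw [hδ]; linarith
  have hfin : (divisor f (closedBall 0 ρ)).support.Finite :=
    (divisor f (closedBall 0 ρ)).finiteSupport (isCompact_closedBall 0 ρ)
  obtain ⟨g, hg, hg0, hfg⟩ := hf.meromorphicOn.extract_zeros_poles (fun u ↦ hf0 u) hfin
  set n := ∑ u ∈ hfin.toFinset, |(divisor f (closedBall 0 ρ) u : ℝ)| with hn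
  have hn0 : 0 ≤ n := Finset.sum_nonneg fun u _ ↦ abs_nonneg _
  have hsupp : (divisor f (closedBall 0 ρ)).support ⊆ closedBall 0 ρ :=
    (divisor f (closedBall 0 ρ)).supportWithinDomain
  have hM := circleAverage_abs_log_norm_le_of_extract hf hfin hsupp hρ1 subset_rfl hg hg0 hfg
  rw [← hn] at hM
  have hTρ : characteristic f ⊤ ρ ≤ T := characteristic_mono hf hρ1 hρR.le
  have hp1 := proximity_le_characteristic (f := f) hρ1
  have hp2 := proximity_le_characteristic (f := f⁻¹) hρ1
  have hp3 := (hinv ρ).1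
  have hnle : n * ((R - ρ) / R) ≤ 2 * T + c := by
    have := sum_abs_divisor_mul_le (fun R ↦ (hinv R).1) hρ1 hρR hfin.toFinset
      (fun u hu ↦ by simpa using hsupp (by simpa using hu))
    refine le_trans (le_of_eq ?_) this
    congr 1
    refine Finset.sum_congr rfl fun u hu ↦ ?_
    rw [divisor_apply hf.meromorphicOn (hsupp (by simpa using hu)),
      divisor_apply hf.meromorphicOn (Set.mem_univ u)]
  set M := circleAverage (fun z ↦ |log ‖g z‖|) 0 ρ with hMdef
  have hM0 : 0 ≤ M := circleAverage_nonneg_of_nonneg (fun w _ ↦ abs_nonneg _)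
  set K := 64 * ρ * (M + 1) / (ρ - r) ^ 2 with hK
  have hK0 : 0 ≤ K := by positivity
  have hmain : proximity (logDeriv f) ⊤ r ≤ 2 * log (2 + K + C₀ * n) := by
    refine hprox _ _ hfin.toFinset K r hf.logDeriv hK0 hr ?_
    refine norm_logDeriv_le_of_extract hf hfin ?_ hg hg0 hfg ?_
    · rw [interior_closedBall _ (by linarith : ρ ≠ 0), abs_of_pos (by linarith)]
      exact closedBall_subset_ball hrρ
    · intro z hz
      rw [abs_of_pos (by linarith)] at hz
      exact norm_logDeriv_le_of_ne_zero hg (fun w hw ↦ hg0 ⟨w, hw⟩) hz.le hrρ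
  have hR1 : 1 ≤ R := by linarith
  have hA := logDeriv_bound_arith (R := R) (ρ := ρ) hc hC₀ hT0 hδ0 hρ1
    (by rw [hρ, hδ]; ring) hM0
    (by have h1 : R - ρ = δ / 2 := by { rw [hρ, hδ]; ring }
        rwa [h1] at hnle) (by linarith)
  have h1 : ρ - r = δ / 2 := by rw [hρ, hδ]; ring
  rw [← h1, ← hK, ← hc₃] at hA
  set X := 1 + T with hX
  set Y := 1 + δ⁻¹ with hY
  have hX1 : 1 ≤ X := by linarith
  have hδi : 0 < δ⁻¹ := inv_pos.2 hδ0
  have hY1 : 1 ≤ Y := by linarith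
  have hlog : log (2 + K + C₀ * n) ≤ log c₃ + log X + 3 * log Y + 3 * log R := by
    refine (log_le_log (by positivity) hA).trans (le_of_eq ?_)
    rw [log_mul (by positivity) (by positivity), log_mul (by positivity) (by positivity),
      log_mul (by positivity) (by positivity), log_pow, log_pow]
    push_cast
    ring
  have hE : logDerivError f r R = 1 + log X + log Y + log R := rfl
  rw [hE]
  have e1 := log_nonneg hX1
  have e2 := log_nonneg hY1
  have e3 := log_nonneg hR1
  have e4 := log_nonneg hc₃1
  nlinarith [mul_nonneg e4 e1, mul_nonneg e4 e2, mul_nonneg e4 e3]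

end ValueDistribution

/-! ### Calculus of error terms; derivatives -/

namespace ValueDistribution

open MeasureTheory Real Metric MeromorphicOn

/-- Linearity and monotonicity of the counting function transfer pointwise comparisons of
multiplicities, with denominators cleared. -/
lemma nat_mul_logCounting_le {D₁ D₂ D₃ : Function.locallyFinsupp ℂ ℤ} {p q s : ℕ} {r : ℝ}
    (h : ∀ z, p * D₁ z ≤ q * D₂ z + s * D₃ z) (hr : 1 ≤ r) :
    p * Function.locallyFinsuppWithin.logCounting D₁ r ≤
      q * Function.locallyFinsuppWithin.logCounting D₂ r +
        s * Function.locallyFinsuppWithin.logCounting D₃ r := by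
  have hle : p • D₁ ≤ q • D₂ + s • D₃ := by
    rw [Function.locallyFinsuppWithin.le_def, Pi.le_def]
    intro z
    simpa using h z
  simpa using Function.locallyFinsuppWithin.logCounting_le hle hr

lemma divisor_univ_apply {f : ℂ → ℂ} (hf : Meromorphic f) (z : ℂ) :
    divisor f Set.univ z = (meromorphicOrderAt f z).untop₀ :=
  divisor_apply hf.meromorphicOn (Set.mem_univ z)

lemma meromorphicOrderAt_deriv_eq_top {f : ℂ → ℂ} {z : ℂ} (h : meromorphicOrderAt f z = ⊤) :
    meromorphicOrderAt (deriv f) z = ⊤ := by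
  rw [meromorphicOrderAt_eq_top_iff] at h ⊢
  have h' : f =ᶠ[𝓝[≠] z] fun _ ↦ 0 := h
  filter_upwards [h'.nhdsNE_deriv] with w hw
  simpa using hw

lemma meromorphicOrderAt_deriv_nonneg {f : ℂ → ℂ} {z : ℂ} (hf : MeromorphicAt f z)
    (h : 0 ≤ meromorphicOrderAt f z) : 0 ≤ meromorphicOrderAt (deriv f) z := by
  obtain ⟨g, hg, hfg⟩ := (MeromorphicAt.meromorphicOrderAt_nonneg_iff hf).1 h
  rw [meromorphicOrderAt_congr hfg.nhdsNE_deriv]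
  exact hg.deriv.meromorphicOrderAt_nonneg

/-- A pole of order p ≥ 1 becomes one of order p + 1 ≤ 2p. -/
lemma logCounting_deriv_le {f : ℂ → ℂ} (hf : Meromorphic f) {r : ℝ} (hr : 1 ≤ r) :
    logCounting (deriv f) ⊤ r ≤ 2 * logCounting f ⊤ r := by
  rw [logCounting_top, logCounting_top]
  have := nat_mul_logCounting_le (D₁ := (divisor (deriv f) Set.univ)⁻)
    (D₂ := (divisor f Set.univ)⁻) (D₃ := 0) (p := 1) (q := 2) (s := 0) (r := r) ?_ hr
  · simpa using this
  intro z
  simp only [Function.locallyFinsuppWithin.negPart_apply, divisor_univ_apply hf,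
    divisor_univ_apply hf.deriv]
  rcases le_or_gt 0 (meromorphicOrderAt f z) with h | h
  · have h2 : 0 ≤ (meromorphicOrderAt (deriv f) z).untop₀ :=
      WithTop.untop₀_nonneg.2 (meromorphicOrderAt_deriv_nonneg (hf z) h)
    rw [negPart_eq_zero.2 h2]
    simp
  · lift meromorphicOrderAt f z to ℤ using h.ne_top with p hp
    have hp0 : p < 0 := by exact_mod_cast h
    rw [meromorphicOrderAt_deriv_eq_sub_one (by exact_mod_cast hp0.ne) hp.symm]
    simp only [WithTop.untop₀_coe, negPart_def]
    simp
    omega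

lemma eventually_codiscrete_ne_zero {f : ℂ → ℂ} (hf : Meromorphic f)
    (hf0 : ∀ z, meromorphicOrderAt f z ≠ ⊤) : ∀ᶠ z in codiscrete ℂ, f z ≠ 0 :=
  hf.meromorphicOn.eventually_codiscreteWithin_apply_ne_zero fun z _ ↦ hf0 z

/-- The error term in estimates of the characteristic function of derived functions. -/
noncomputable def characteristicError (f : ℂ → ℂ) (r R : ℝ) : ℝ :=
  1 + characteristic f ⊤ R + log (1 + (R - r)⁻¹) + log R

/-- The characteristic function of `g` is dominated by that of `f`. -/
def CharacteristicDominated (f g : ℂ → ℂ) : Prop :=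
  ∃ C : ℝ, 0 ≤ C ∧ ∀ r R : ℝ, 1 ≤ r → r < R → characteristic g ⊤ r ≤ C * characteristicError f r R

/-- The proximity function of `h` is negligible compared to the characteristic function of `f`. -/
def ProximityNegligible (f h : ℂ → ℂ) : Prop :=
  ∃ C : ℝ, 0 ≤ C ∧ ∀ r R : ℝ, 1 ≤ r → r < R → proximity h ⊤ r ≤ C * logDerivError f r R

section Error

variable {f : ℂ → ℂ} {r R : ℝ}

lemma log_one_add_inv_sub_nonneg (h : r < R) : 0 ≤ log (1 + (R - r)⁻¹) :=
  log_nonneg (by have := inv_pos.2 (sub_pos.2 h); linarith)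

lemma one_le_logDerivError (hr : 1 ≤ r) (h : r < R) : 1 ≤ logDerivError f r R := by
  have h1 := log_nonneg (by linarith : 1 ≤ R)
  have h2 := log_one_add_inv_sub_nonneg h
  have h3 : 0 ≤ characteristic f ⊤ R := characteristic_nonneg (by linarith)
  have h4 := log_nonneg (by linarith : 1 ≤ 1 + characteristic f ⊤ R)
  unfold logDerivError
  linarith

lemma logDerivError_le_characteristicError (hr : 1 ≤ r) (h : r < R) :
    logDerivError f r R ≤ characteristicError f r R := by
  have h3 : 0 ≤ characteristic f ⊤ R := characteristic_nonneg (by linarith)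
  have := log_le_sub_one_of_pos (x := 1 + characteristic f ⊤ R) (by linarith)
  unfold logDerivError characteristicError
  linarith

lemma one_le_characteristicError (hr : 1 ≤ r) (h : r < R) : 1 ≤ characteristicError f r R :=
  (one_le_logDerivError hr h).trans (logDerivError_le_characteristicError hr h)

lemma characteristic_le_characteristicError (hf : Meromorphic f) (hr : 1 ≤ r) (h : r < R) :
    characteristic f ⊤ r ≤ characteristicError f r R := by
  have h1 := log_nonneg (by linarith : 1 ≤ R)
  have h2 := log_one_add_inv_sub_nonneg h
  have h3 := characteristic_mono hf hr h.le
  unfold characteristicError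
  linarith

lemma log_one_add_inv_half_le (h : r < R) :
    log (1 + (R - (r + R) / 2)⁻¹) ≤ 1 + log (1 + (R - r)⁻¹) := by
  have h0 := inv_pos.2 (sub_pos.2 h)
  have h1 : (R - (r + R) / 2)⁻¹ = 2 * (R - r)⁻¹ := by
    rw [show R - (r + R) / 2 = (R - r) / 2 by ring, inv_div]; rfl
  have h2 : log (1 + (R - (r + R) / 2)⁻¹) ≤ log (2 * (1 + (R - r)⁻¹)) :=
    log_le_log (by rw [h1]; positivity) (by rw [h1]; linarith)
  rw [log_mul (by norm_num) (by positivity)] at h2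
  linarith [log_two_lt_d9]

lemma log_one_add_inv_half_le' (h : r < R) :
    log (1 + ((r + R) / 2 - r)⁻¹) ≤ 1 + log (1 + (R - r)⁻¹) := by
  rw [show (r + R) / 2 - r = R - (r + R) / 2 by ring]
  exact log_one_add_inv_half_le h

lemma characteristicError_half_le (hr : 1 ≤ r) (h : r < R) :
    characteristicError f ((r + R) / 2) R ≤ 2 * characteristicError f r R := by
  have h1 := log_nonneg (by linarith : 1 ≤ R)
  have h2 := log_one_add_inv_sub_nonneg h
  have h3 : 0 ≤ characteristic f ⊤ R := characteristic_nonneg (by linarith)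
  have h4 := log_one_add_inv_half_le h
  unfold characteristicError
  linarith

/-- From 1 + x + y + z ≤ (1 + x)(1 + y)(1 + z) and log (1 + y) ≤ y. This keeps the error logarithmic
in T when the lemma on the logarithmic derivative is applied to derived functions. -/
lemma log_characteristicError_le (hr : 1 ≤ r) (h : r < R) :
    log (characteristicError f r R) ≤ logDerivError f r R := by
  have h1 := log_nonneg (by linarith : 1 ≤ R)
  have h2 := log_one_add_inv_sub_nonneg h
  have h3 : 0 ≤ characteristic f ⊤ R := characteristic_nonneg (by linarith)
  have h4 : characteristicError f r R ≤
      (1 + characteristic f ⊤ R) * ((1 + log (1 + (R - r)⁻¹)) * (1 + log R)) := by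
    have h5 : 1 + (log (1 + (R - r)⁻¹) + log R) ≤ (1 + log (1 + (R - r)⁻¹)) * (1 + log R) := by
      nlinarith [mul_nonneg h1 h2]
    have h6 : (1 + characteristic f ⊤ R) * (1 + (log (1 + (R - r)⁻¹) + log R)) ≤
      (1 + characteristic f ⊤ R) * ((1 + log (1 + (R - r)⁻¹)) * (1 + log R)) := by gcongr
    refine le_trans ?_ h6
    have : 0 ≤ characteristic f ⊤ R * (log (1 + (R - r)⁻¹) + log R) := by positivity
    unfold characteristicError
    linarith
  have h0 := one_le_characteristicError (f := f) hr h
  refine (log_le_log (by linarith) h4).trans ?_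
  rw [log_mul (by positivity) (by positivity), log_mul (by positivity) (by positivity)]
  have h7 := log_le_sub_one_of_pos (x := 1 + log (1 + (R - r)⁻¹)) (by linarith)
  have h8 := log_le_sub_one_of_pos (x := 1 + log R) (by linarith)
  unfold logDerivError
  linarith

end Error

section Calculus

variable {f g h : ℂ → ℂ}

lemma CharacteristicDominated.refl (hf : Meromorphic f) : CharacteristicDominated f f :=
  ⟨1, zero_le_one, fun r R hr hR ↦ by
    simpa using characteristic_le_characteristicError hf hr hR⟩

lemma CharacteristicDominated.pow (hg : Meromorphic g) (n : ℕ) (hfg : CharacteristicDominated f g) :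
    CharacteristicDominated f (g ^ n) := by
  obtain ⟨C, hC, H⟩ := hfg
  refine ⟨n * C, by positivity, fun r R hr hR ↦ ?_⟩
  rw [characteristic_pow_top hg, Pi.smul_apply, nsmul_eq_mul, mul_assoc]
  gcongr
  exact H r R hr hR

lemma CharacteristicDominated.mul (hg : Meromorphic g) (hg0 : ∀ z, meromorphicOrderAt g z ≠ ⊤)
    (hh : Meromorphic h) (hh0 : ∀ z, meromorphicOrderAt h z ≠ ⊤)
    (hfg : CharacteristicDominated f g) (hfh : CharacteristicDominated f h) :
    CharacteristicDominated f (g * h) := by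
  obtain ⟨C, hC, H⟩ := hfg
  obtain ⟨C', hC', H'⟩ := hfh
  refine ⟨C + C', by positivity, fun r R hr hR ↦ ?_⟩
  refine (characteristic_mul_top_le hr hg hg0 hh hh0).trans ?_
  rw [add_mul, Pi.add_apply]
  exact add_le_add (H r R hr hR) (H' r R hr hR)

lemma CharacteristicDominated.sub_const (hg : Meromorphic g) (a : ℂ)
    (hfg : CharacteristicDominated f g) : CharacteristicDominated f (fun z ↦ g z - a) := by
  obtain ⟨C, hC, H⟩ := hfg
  refine ⟨C + (log⁺ ‖a‖ + log 2), add_nonneg hC (add_nonneg posLog_nonneg (log_nonneg (by norm_num))),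
    fun r R hr hR ↦ ?_⟩
  have h1 := abs_le.1 (abs_characteristic_sub_characteristic_shift_le (r := r) (a₀ := a) hg)
  have h2 := one_le_characteristicError (f := f) hr hR
  have h3 : 0 ≤ log⁺ ‖a‖ := posLog_nonneg
  have h4 : 0 ≤ log 2 := log_nonneg (by norm_num)
  have h5 : (log⁺ ‖a‖ + log 2) * 1 ≤ (log⁺ ‖a‖ + log 2) * characteristicError f r R := by gcongr
  rw [add_mul]
  linarith [H r R hr hR, h1.1]

/-- Iterated form of the lemma on the logarithmic derivative. -/
lemma CharacteristicDominated.proximityNegligible_logDeriv (hg : Meromorphic g)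
    (hg0 : ∀ z, meromorphicOrderAt g z ≠ ⊤) (hfg : CharacteristicDominated f g) :
    ProximityNegligible f (logDeriv g) := by
  obtain ⟨C, hC, H⟩ := hfg
  obtain ⟨C', hC', H'⟩ := exists_proximity_logDeriv_le hg hg0
  have hl : 0 ≤ log (1 + 2 * C) := log_nonneg (by linarith)
  refine ⟨C' * (log (1 + 2 * C) + 3), by positivity, fun r R hr hR ↦ ?_⟩
  -- Two estimates are chained through the midpoint; halving the gap costs a bounded amount.
  refine (H' r ((r + R) / 2) hr (by linarith)).trans ?_
  rw [mul_assoc]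
  gcongr
  have h1 := H ((r + R) / 2) R (by linarith) (by linarith)
  have h2 := characteristicError_half_le (f := f) hr hR
  have h3 := one_le_characteristicError (f := f) hr hR
  have h4 : 1 + characteristic g ⊤ ((r + R) / 2) ≤ (1 + 2 * C) * characteristicError f r R := by
    have : C * characteristicError f ((r + R) / 2) R ≤ C * (2 * characteristicError f r R) := by
      gcongr
    linarith
  have h5 : 0 ≤ characteristic g ⊤ ((r + R) / 2) := characteristic_nonneg (by linarith)
  have h6 := log_le_log (by linarith) h4
  rw [log_mul (by positivity) (by positivity)] at h6
  have h7 := log_characteristicError_le (f := f) hr hR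
  have h8 := log_one_add_inv_half_le' hR
  have h9 : log ((r + R) / 2) ≤ log R := log_le_log (by linarith) (by linarith)
  have h10 := one_le_logDerivError (f := f) hr hR
  have h11 : log (1 + 2 * C) * 1 ≤ log (1 + 2 * C) * logDerivError f r R := by gcongr
  have h12 : log (1 + (R - r)⁻¹) + log R ≤ logDerivError f r R - 1 := by
    have h3 : 0 ≤ characteristic f ⊤ R := characteristic_nonneg (by linarith)
    have h4 := log_nonneg (by linarith : 1 ≤ 1 + characteristic f ⊤ R)
    unfold logDerivError
    linarith
  rw [logDerivError.eq_def g]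
  linarith

/-- Write g' = g · (g'/g) for the proximity function; the poles at most double in number. -/
lemma CharacteristicDominated.deriv (hg : Meromorphic g)
    (hg0 : ∀ z, meromorphicOrderAt g z ≠ ⊤) (hfg : CharacteristicDominated f g) :
    CharacteristicDominated f (deriv g) := by
  obtain ⟨C', hC', H'⟩ := hfg.proximityNegligible_logDeriv hg hg0
  obtain ⟨C, hC, H⟩ := hfg
  refine ⟨C' + 2 * C, by positivity, fun r R hr hR ↦ ?_⟩
  have heq : _root_.deriv g =ᶠ[codiscrete ℂ] g * logDeriv g := by
    filter_upwards [eventually_codiscrete_ne_zero hg hg0] with z hz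
    simp [logDeriv_apply, mul_div_cancel₀ _ hz]
  have h1 : proximity (_root_.deriv g) ⊤ r ≤ proximity g ⊤ r + proximity (logDeriv g) ⊤ r := by
    rw [proximity_congr_codiscrete heq (by linarith)]
    exact proximity_mul_top_le hg hg.logDeriv r
  have h2 := logCounting_deriv_le hg hr
  have h3 := H' r R hr hR
  have h4 : C' * logDerivError f r R ≤ C' * characteristicError f r R := by
    gcongr
    exact logDerivError_le_characteristicError hr hR
  have h5 := H r R hr hR
  have h6 : 0 ≤ proximity g ⊤ r := proximity_nonneg r
  simp only [characteristic, Pi.add_apply] at h5 ⊢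
  linarith

lemma ProximityNegligible.mul (hg : Meromorphic g) (hh : Meromorphic h)
    (hfg : ProximityNegligible f g) (hfh : ProximityNegligible f h) :
    ProximityNegligible f (g * h) := by
  obtain ⟨C, hC, H⟩ := hfg
  obtain ⟨C', hC', H'⟩ := hfh
  refine ⟨C + C', by positivity, fun r R hr hR ↦ ?_⟩
  refine (proximity_mul_top_le hg hh r).trans ?_
  rw [add_mul, Pi.add_apply]
  exact add_le_add (H r R hr hR) (H' r R hr hR)

lemma ProximityNegligible.add (hg : Meromorphic g) (hh : Meromorphic h)
    (hfg : ProximityNegligible f g) (hfh : ProximityNegligible f h) :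
    ProximityNegligible f (g + h) := by
  obtain ⟨C, hC, H⟩ := hfg
  obtain ⟨C', hC', H'⟩ := hfh
  have h0 : 0 ≤ log 2 := log_nonneg (by norm_num)
  refine ⟨C + C' + log 2, by positivity, fun r R hr hR ↦ ?_⟩
  refine (proximity_add_top_le hg hh r).trans ?_
  have h1 : log 2 * 1 ≤ log 2 * logDerivError f r R := by
    gcongr
    exact one_le_logDerivError hr hR
  simp only [Pi.add_apply]
  linarith [H r R hr hR, H' r R hr hR]

lemma ProximityNegligible.const (f : ℂ → ℂ) (a : ℂ) : ProximityNegligible f (fun _ ↦ a) := by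
  refine ⟨log⁺ ‖a‖, posLog_nonneg, fun r R hr hR ↦ ?_⟩
  rw [proximity_const]
  exact le_mul_of_one_le_right posLog_nonneg (one_le_logDerivError hr hR)

lemma ProximityNegligible.congr (hfg : ProximityNegligible f g) (hgh : g =ᶠ[codiscrete ℂ] h) :
    ProximityNegligible f h := by
  obtain ⟨C, hC, H⟩ := hfg
  refine ⟨C, hC, fun r R hr hR ↦ ?_⟩
  rw [← proximity_congr_codiscrete hgh (by linarith)]
  exact H r R hr hR

end Calculus

section IteratedDeriv

variable {f : ℂ → ℂ} {k : ℕ}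

lemma meromorphic_iteratedDeriv (hf : Meromorphic f) (k : ℕ) : Meromorphic (iteratedDeriv k f) := by
  rw [iteratedDeriv_eq_iterate]
  exact hf.iterated_deriv

lemma meromorphicOrderAt_iteratedDeriv_ne_top
    (hk : ∀ z, meromorphicOrderAt (iteratedDeriv k f) z ≠ ⊤) {j : ℕ} (hj : j ≤ k) (z : ℂ) :
    meromorphicOrderAt (iteratedDeriv j f) z ≠ ⊤ := by
  induction hj using Nat.decreasingInduction with
  | of_succ m _ ih =>
    intro h
    apply ih
    rw [iteratedDeriv_succ]
    exact meromorphicOrderAt_deriv_eq_top h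
  | self => exact hk z

lemma characteristicDominated_iteratedDeriv (hf : Meromorphic f)
    (hk : ∀ z, meromorphicOrderAt (iteratedDeriv k f) z ≠ ⊤) {j : ℕ} (hj : j ≤ k) :
    CharacteristicDominated f (iteratedDeriv j f) := by
  induction j with
  | zero => simpa using CharacteristicDominated.refl hf
  | succ m ih =>
    rw [iteratedDeriv_succ]
    exact (ih (by omega)).deriv (meromorphic_iteratedDeriv hf m)
      (meromorphicOrderAt_iteratedDeriv_ne_top hk (by omega))

/-- The quotient telescopes into logarithmic derivatives of the successive derivatives of f. -/
lemma proximityNegligible_iteratedDeriv_div (hf : Meromorphic f)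
    (hk : ∀ z, meromorphicOrderAt (iteratedDeriv k f) z ≠ ⊤) {j : ℕ} (hj : j ≤ k) :
    ProximityNegligible f (iteratedDeriv j f / f) := by
  induction j with
  | zero =>
    refine (ProximityNegligible.const f 1).congr ?_
    have := meromorphicOrderAt_iteratedDeriv_ne_top hk (Nat.zero_le k)
    simp only [iteratedDeriv_zero] at this
    filter_upwards [eventually_codiscrete_ne_zero hf this] with z hz
    simp [hz]
  | succ m ih =>
    have hm := meromorphic_iteratedDeriv hf m
    have hm0 := meromorphicOrderAt_iteratedDeriv_ne_top hk (by omega : m ≤ k)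
    refine ((ih (by omega)).mul (hm.div hf) hm.logDeriv
      ((characteristicDominated_iteratedDeriv hf hk
        (by omega)).proximityNegligible_logDeriv hm hm0)).congr ?_
    filter_upwards [eventually_codiscrete_ne_zero hm hm0] with z hz
    simp only [Pi.mul_apply, Pi.div_apply, logDeriv_apply, iteratedDeriv_succ]
    field_simp

end IteratedDeriv

end ValueDistribution

/-! ### A second main theorem from multiplicities -/

namespace ValueDistribution

open MeasureTheory Real Metric MeromorphicOn

section SecondMainTheorem

variable {F : ℂ → ℂ} {a : ℂ}

lemma meromorphicOrderAt_sub_const_of_neg {z : ℂ} (a : ℂ)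
    (h : meromorphicOrderAt F z < 0) :
    meromorphicOrderAt (fun w ↦ F w - a) z = meromorphicOrderAt F z := by
  have : (fun w ↦ F w - a) = F + fun _ ↦ -a := by ext; simp [sub_eq_add_neg]
  rw [this]
  refine meromorphicOrderAt_add_eq_left_of_lt (MeromorphicAt.const (-a) z) (h.trans_le ?_)
  exact analyticAt_const.meromorphicOrderAt_nonneg

lemma meromorphicOrderAt_sub_const_of_pos {z : ℂ} (hF : MeromorphicAt F z) (ha : a ≠ 0)
    (h : 0 < meromorphicOrderAt F z) :
    meromorphicOrderAt (fun w ↦ F w - a) z = 0 := by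
  have : (fun w ↦ F w - a) = F + fun _ ↦ -a := by ext; simp [sub_eq_add_neg]
  have h0 : meromorphicOrderAt (fun _ : ℂ ↦ -a) z = 0 := by
    simp [meromorphicOrderAt_const, ha]
  rw [this, meromorphicOrderAt_add_eq_right_of_lt hF (by rwa [h0]), h0]

lemma meromorphicOrderAt_sub_const_nonneg {z : ℂ} (hF : MeromorphicAt F z) (a : ℂ)
    (h : 0 ≤ meromorphicOrderAt F z) :
    0 ≤ meromorphicOrderAt (fun w ↦ F w - a) z := by
  have : (fun w ↦ F w - a) = F + fun _ ↦ -a := by ext; simp [sub_eq_add_neg]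
  rw [this]
  exact (le_min h analyticAt_const.meromorphicOrderAt_nonneg).trans
    (meromorphicOrderAt_add hF (MeromorphicAt.const (-a) z))

/-- The difference of the logarithmic derivatives of `F - a` and `F`, divided by `a`. -/
noncomputable def auxQuotient (F : ℂ → ℂ) (a : ℂ) : ℂ → ℂ :=
  (fun _ ↦ a⁻¹) * (logDeriv (fun w ↦ F w - a) + (fun _ ↦ -1) * logDeriv F)

/-- Partial fractions. The sum form has small proximity function, the product form shows the orders.
-/
lemma auxQuotient_apply {z : ℂ} (ha : a ≠ 0) (h0 : F z ≠ 0) (h1 : F z - a ≠ 0) :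
    auxQuotient F a z = (deriv F * (F * fun w ↦ F w - a)⁻¹) z := by
  simp only [auxQuotient, Pi.mul_apply, Pi.add_apply, logDeriv_apply, Pi.inv_apply,
    deriv_sub_const]
  field_simp
  ring

lemma meromorphic_auxQuotient (hF : Meromorphic F) (a : ℂ) : Meromorphic (auxQuotient F a) := by
  have hG : Meromorphic (fun w ↦ F w - a) := hF.sub (Meromorphic.const a)
  exact (Meromorphic.const _).mul (hG.logDeriv.add ((Meromorphic.const _).mul hF.logDeriv))

lemma meromorphicOrderAt_auxQuotient (hF : Meromorphic F) (ha : a ≠ 0)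
    {z : ℂ} (hF0 : meromorphicOrderAt F z ≠ ⊤)
    (hG0 : meromorphicOrderAt (fun w ↦ F w - a) z ≠ ⊤) :
    meromorphicOrderAt (auxQuotient F a) z = meromorphicOrderAt (deriv F) z +
      -(meromorphicOrderAt F z + meromorphicOrderAt (fun w ↦ F w - a) z) := by
  have hG : Meromorphic (fun w ↦ F w - a) := hF.sub (Meromorphic.const a)
  have h1 := (meromorphicOrderAt_ne_top_iff_eventually_ne_zero (hF z)).1 hF0
  have h2 := (meromorphicOrderAt_ne_top_iff_eventually_ne_zero (hG z)).1 hG0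
  have : auxQuotient F a =ᶠ[𝓝[≠] z] deriv F * (F * fun w ↦ F w - a)⁻¹ := by
    filter_upwards [h1, h2] with w hw1 hw2 using auxQuotient_apply ha hw1 hw2
  rw [meromorphicOrderAt_congr this, meromorphicOrderAt_mul (hF z).deriv ((hF z).mul (hG z)).inv,
    meromorphicOrderAt_inv, meromorphicOrderAt_mul (hF z) (hG z)]

/-- Pointwise comparison of multiplicities behind the second main theorem below. -/
lemma divisor_auxQuotient_bounds (hF : Meromorphic F) (ha : a ≠ 0)
    (hF0 : ∀ z, meromorphicOrderAt F z ≠ ⊤)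
    (hG0 : ∀ z, meromorphicOrderAt (fun w ↦ F w - a) z ≠ ⊤)
    (hF' : ∀ z, meromorphicOrderAt (deriv F) z ≠ ⊤)
    (hpole : ∀ z, meromorphicOrderAt F z < 0 → meromorphicOrderAt F z ≤ (-3 : ℤ))
    (hzero : ∀ z, 0 < meromorphicOrderAt F z → (2 : ℤ) ≤ meromorphicOrderAt F z) (z : ℂ) :
    2 * (divisor F Set.univ)⁻ z ≤ 3 * (divisor (auxQuotient F a) Set.univ)⁺ z ∧
    2 * (divisor (auxQuotient F a) Set.univ)⁻ z ≤
      (divisor F Set.univ)⁺ z + 2 * (divisor (fun w ↦ F w - a) Set.univ)⁺ z := by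
  have hG : Meromorphic (fun w ↦ F w - a) := hF.sub (Meromorphic.const a)
  have hdG : deriv (fun w ↦ F w - a) = deriv F := by ext w; simp
  simp only [Function.locallyFinsuppWithin.negPart_apply,
    Function.locallyFinsuppWithin.posPart_apply, divisor_univ_apply hF, divisor_univ_apply hG,
    divisor_univ_apply (meromorphic_auxQuotient hF a),
    meromorphicOrderAt_auxQuotient hF ha (hF0 z) (hG0 z)]
  have e1 := meromorphicOrderAt_sub_const_of_neg (F := F) (z := z) a
  have e2 := meromorphicOrderAt_sub_const_of_pos (hF z) ha
  have e3 := meromorphicOrderAt_sub_const_nonneg (hF z) a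
  have e4 := fun (n : ℤ) (hn : n ≠ 0) ↦
    meromorphicOrderAt_deriv_eq_sub_one (f := F) (x := z) (n := n) (by exact_mod_cast hn)
  have e5 := fun (n : ℤ) (hn : n ≠ 0) ↦
    meromorphicOrderAt_deriv_eq_sub_one (f := fun w ↦ F w - a) (x := z) (n := n)
      (by exact_mod_cast hn)
  have e6 := meromorphicOrderAt_deriv_nonneg (hF z)
  have e7 := hpole z
  have e8 := hzero z
  rw [hdG] at e5
  have hp0 := hF0 z
  have hq0 := hG0 z
  have hs0 := hF' z
  generalize meromorphicOrderAt F z = p at *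
  generalize meromorphicOrderAt (fun w ↦ F w - a) z = q at *
  generalize meromorphicOrderAt (deriv F) z = s at *
  lift p to ℤ using hp0
  lift q to ℤ using hq0
  lift s to ℤ using hs0
  have hcalc : ((s : WithTop ℤ) + -((p : WithTop ℤ) + (q : WithTop ℤ))).untop₀ = s - (p + q) := by
    rw [← WithTop.coe_add, ← WithTop.LinearOrderedAddCommGroup.coe_neg, ← WithTop.coe_add,
      WithTop.untop₀_coe]
    ring
  rw [hcalc]
  simp only [WithTop.untop₀_coe, negPart_def, posPart_def]
  norm_cast at e1 e2 e3 e4 e5 e6 e7 e8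
  -- A pole of F of order m ≥ 3 is a zero of φ of order m - 1, and 2m ≤ 3(m - 1). An a-point, or a
  -- zero of order m ≥ 2, is a simple pole of φ, paid for by 2 ≤ 2q at an a-point of order q and by
  -- 2 ≤ m at a zero.
  rcases lt_trichotomy p 0 with h | h | h
  · have := e4 p h.ne rfl
    have := e1 h
    have := e7 h
    omega
  · rcases (e3 h.ge).eq_or_lt with hq | hq
    · have := e6 h.ge
      omega
    · have := e5 q hq.ne' rfl
      omega
  · have := e4 p h.ne' rfl
    have := e2 h
    have := e8 h
    omega

/-- A second main theorem for functions whose poles have multiplicity at least three and whose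
zeros are multiple: the characteristic function of `F` is controlled by the counting function of
the `a`-points. -/
theorem exists_characteristic_le_logCounting {f : ℂ → ℂ} (hF : Meromorphic F) (ha : a ≠ 0)
    (hF0 : ∀ z, meromorphicOrderAt F z ≠ ⊤)
    (hG0 : ∀ z, meromorphicOrderAt (fun w ↦ F w - a) z ≠ ⊤)
    (hF' : ∀ z, meromorphicOrderAt (deriv F) z ≠ ⊤)
    (hpole : ∀ z, meromorphicOrderAt F z < 0 → meromorphicOrderAt F z ≤ (-3 : ℤ))
    (hzero : ∀ z, 0 < meromorphicOrderAt F z → (2 : ℤ) ≤ meromorphicOrderAt F z)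
    (hfF : CharacteristicDominated f F) :
    ∃ C : ℝ, 0 ≤ C ∧ ∀ r R : ℝ, 1 ≤ r → r < R → characteristic F ⊤ r ≤
      C * logDerivError f r R + 6 * logCounting (fun w ↦ F w - a) 0 r := by
  have hG : Meromorphic (fun w ↦ F w - a) := hF.sub (Meromorphic.const a)
  set G : ℂ → ℂ := fun w ↦ F w - a with hGdef
  set φ := auxQuotient F a with hφdef
  have hφ : Meromorphic φ := meromorphic_auxQuotient hF a
  have nF := hfF.proximityNegligible_logDeriv hF hF0
  have nG : ProximityNegligible f (logDeriv G) :=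
    (hfF.sub_const hF a).proximityNegligible_logDeriv hG hG0
  have nφ : ProximityNegligible f φ := by
    refine (ProximityNegligible.const f _).mul (Meromorphic.const _)
      (hG.logDeriv.add ((Meromorphic.const _).mul hF.logDeriv)) (nG.add hG.logDeriv
        ((Meromorphic.const _).mul hF.logDeriv) ?_)
    exact (ProximityNegligible.const f _).mul (Meromorphic.const _) hF.logDeriv nF
  -- F = (F'/(F - a))/φ bounds the proximity function of F by that of 1/φ plus an error.
  have heq : F =ᶠ[codiscrete ℂ] logDeriv G * φ⁻¹ := by
    filter_upwards [eventually_codiscrete_ne_zero hF hF0, eventually_codiscrete_ne_zero hG hG0,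
      eventually_codiscrete_ne_zero hF.deriv hF'] with z h1 h2 h3
    have h2' : F z - a ≠ 0 := h2
    rw [Pi.mul_apply, Pi.inv_apply, hφdef, auxQuotient_apply ha h1 h2, logDeriv_apply]
    simp only [hGdef, Pi.mul_apply, Pi.inv_apply, deriv_sub_const]
    field_simp
  obtain ⟨C₁, hC₁, H₁⟩ := nG
  obtain ⟨C₂, hC₂, H₂⟩ := nφ
  obtain ⟨c₁, hc₁, K₁⟩ := exists_characteristic_inv_le hφ
  obtain ⟨c₂, hc₂, K₂⟩ := exists_characteristic_inv_le hF
  refine ⟨6 * (C₁ + C₂ + c₁ + c₂), by positivity, fun r R hr hR ↦ ?_⟩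
  have hE := one_le_logDerivError (f := f) hr hR
  have m1 : proximity F ⊤ r ≤ proximity (logDeriv G) ⊤ r + proximity φ⁻¹ ⊤ r := by
    rw [proximity_congr_codiscrete heq (by linarith)]
    exact proximity_mul_top_le hG.logDeriv hφ.inv r
  have m2 := (K₁ r).1
  have m3 := (K₂ r).1
  have m4 := H₁ r R hr hR
  have m5 := H₂ r R hr hR
  have hb := divisor_auxQuotient_bounds hF ha hF0 hG0 hF' hpole hzero
  have m6 := nat_mul_logCounting_le (p := 2) (q := 3) (s := 0) (D₁ := (divisor F Set.univ)⁻)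
    (D₂ := (divisor φ Set.univ)⁺) (D₃ := 0) (r := r)
    (fun z ↦ by simpa using (hb z).1) hr
  have m7 := nat_mul_logCounting_le (p := 2) (q := 1) (s := 2) (D₁ := (divisor φ Set.univ)⁻)
    (D₂ := (divisor F Set.univ)⁺) (D₃ := (divisor G Set.univ)⁺) (r := r)
    (fun z ↦ by simpa using (hb z).2) hr
  rw [← logCounting_top, ← logCounting_zero] at m6
  rw [← logCounting_top, ← logCounting_zero, ← logCounting_zero] at m7
  have m8 : 0 ≤ proximity F⁻¹ ⊤ r := proximity_nonneg r
  have m9 : 0 ≤ proximity F ⊤ r := proximity_nonneg r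
  simp only [characteristic, Pi.add_apply, logCounting_inv] at m2 m3 ⊢
  have m10 : (c₁ + c₂) * 1 ≤ (c₁ + c₂) * logDerivError f r R := by gcongr
  norm_num at m6 m7
  -- Up to errors, T(F) ≤ (3/2) T(1/φ) ≤ (3/2) N(φ) ≤ (3/4) T(F) + (3/2) N(1/(F - a)); solving for
  -- T(F) produces the factor 6.
  linarith

end SecondMainTheorem

end ValueDistribution

/-! ### Orders and growth of the differential monomial -/

namespace ValueDistribution

open MeasureTheory Real Metric MeromorphicOn

lemma meromorphic_pow {f : ℂ → ℂ} (hf : Meromorphic f) (n : ℕ) : Meromorphic (f ^ n) :=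
  fun z ↦ (hf z).pow n

section DiffMonomial

variable {f : ℂ → ℂ} {k l n : ℕ}

lemma diffMonomial_eq_mul (f : ℂ → ℂ) (k l n : ℕ) :
    diffMonomial f k l n = f ^ l * iteratedDeriv k f ^ n := rfl

lemma meromorphic_diffMonomial (hf : Meromorphic f) (k l n : ℕ) :
    Meromorphic (diffMonomial f k l n) :=
  (meromorphic_pow hf l).mul (meromorphic_pow (meromorphic_iteratedDeriv hf k) n)

lemma meromorphicOrderAt_diffMonomial (hf : Meromorphic f) (k l n : ℕ) (z : ℂ) :
    meromorphicOrderAt (diffMonomial f k l n) z =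
      l * meromorphicOrderAt f z + n * meromorphicOrderAt (iteratedDeriv k f) z := by
  have hk := meromorphic_iteratedDeriv hf k
  rw [diffMonomial_eq_mul, meromorphicOrderAt_mul ((hf z).pow l) ((hk z).pow n),
    meromorphicOrderAt_pow (hf z), meromorphicOrderAt_pow (hk z)]

lemma meromorphicOrderAt_iteratedDeriv_of_neg {z : ℂ} {p : ℤ} (hp : p < 0)
    (h : meromorphicOrderAt f z = p) (k : ℕ) :
    meromorphicOrderAt (iteratedDeriv k f) z = ((p - k : ℤ) : WithTop ℤ) := by
  induction k with
  | zero => simpa using h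
  | succ m ih =>
    rw [iteratedDeriv_succ,
      meromorphicOrderAt_deriv_eq_sub_one (by exact_mod_cast (by omega : p - m ≠ 0)) ih]
    congr 1
    push_cast
    ring

lemma meromorphicOrderAt_iteratedDeriv_nonneg (hf : Meromorphic f) {z : ℂ}
    (h : 0 ≤ meromorphicOrderAt f z) (k : ℕ) :
    0 ≤ meromorphicOrderAt (iteratedDeriv k f) z := by
  induction k with
  | zero => simpa using h
  | succ m ih =>
    rw [iteratedDeriv_succ]
    exact meromorphicOrderAt_deriv_nonneg (meromorphic_iteratedDeriv hf m z) ih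

/-- The orders of `f` and of the monomial `f ^ l * (f^{(k)}) ^ n`: either `f` has a pole and the
monomial has a pole of multiplicity at least three, or the monomial is holomorphic with zeros of
multiplicity at least two and at least the multiplicity of the zero of `f`. -/
lemma exists_meromorphicOrderAt_diffMonomial (hf : Meromorphic f)
    (hf0 : ∀ z, meromorphicOrderAt (iteratedDeriv k f) z ≠ ⊤)
    (hk : 1 ≤ k) (hl : 2 ≤ l) (hn : 2 ≤ n) (z : ℂ) :
    ∃ p P : ℤ, meromorphicOrderAt f z = p ∧ meromorphicOrderAt (diffMonomial f k l n) z = P ∧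
      ((p < 0 ∧ P ≤ -3) ∨ (0 ≤ p ∧ p ≤ P ∧ (P = 0 ∨ 2 ≤ P))) := by
  have h0 : meromorphicOrderAt f z ≠ ⊤ := by
    simpa using meromorphicOrderAt_iteratedDeriv_ne_top hf0 (Nat.zero_le k) z
  have hs0 := hf0 z
  have e1 := fun (p : ℤ) (hp : p < 0) ↦
    meromorphicOrderAt_iteratedDeriv_of_neg (f := f) (z := z) (p := p) hp
  have e2 := fun h ↦ meromorphicOrderAt_iteratedDeriv_nonneg hf (z := z) h k
  rw [meromorphicOrderAt_diffMonomial hf]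
  generalize meromorphicOrderAt f z = p at *
  lift p to ℤ using h0
  specialize e1 p
  simp only [forall_true_left] at e1
  have e1' := fun hp ↦ e1 hp k
  clear e1
  generalize meromorphicOrderAt (iteratedDeriv k f) z = s at *
  lift s to ℤ using hs0
  norm_cast at e1' e2
  refine ⟨p, l * p + n * s, rfl, by push_cast; rfl, ?_⟩
  have hl' : (2 : ℤ) ≤ l := by exact_mod_cast hl
  have hn' : (2 : ℤ) ≤ n := by exact_mod_cast hn
  rcases lt_or_ge p 0 with hp | hp
  · left
    have hs : s = p - k := e1' hp
    have hk' : (1 : ℤ) ≤ k := by exact_mod_cast hk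
    refine ⟨hp, ?_⟩
    have h1 : (l : ℤ) * p ≤ 2 * p := by nlinarith
    have h2 : (n : ℤ) * s ≤ 2 * s := by nlinarith
    omega
  · right
    have hs : 0 ≤ s := e2 hp
    have h1 : 2 * p ≤ (l : ℤ) * p := by gcongr
    have h2 : 2 * s ≤ (n : ℤ) * s := by gcongr
    refine ⟨hp, by omega, ?_⟩
    by_cases h : p = 0 ∧ s = 0
    · left; simp [h.1, h.2]
    · right; omega

lemma characteristicDominated_diffMonomial (hf : Meromorphic f)
    (hf0 : ∀ z, meromorphicOrderAt (iteratedDeriv k f) z ≠ ⊤) (l n : ℕ) :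
    CharacteristicDominated f (diffMonomial f k l n) := by
  have hk := meromorphic_iteratedDeriv hf k
  have h0 : ∀ z, meromorphicOrderAt f z ≠ ⊤ := by
    simpa using fun z ↦ meromorphicOrderAt_iteratedDeriv_ne_top hf0 (Nat.zero_le k) z
  have hpow : ∀ {g : ℂ → ℂ}, Meromorphic g → (∀ z, meromorphicOrderAt g z ≠ ⊤) →
      ∀ (m : ℕ) z, meromorphicOrderAt (g ^ m) z ≠ ⊤ := fun {g} hg hg0 m z ↦ by
    rw [meromorphicOrderAt_pow (hg z)]
    lift meromorphicOrderAt g z to ℤ using hg0 z with p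
    exact_mod_cast WithTop.coe_ne_top
  exact ((CharacteristicDominated.refl hf).pow hf l).mul (meromorphic_pow hf l) (hpow hf h0 l) (meromorphic_pow hk n)
    (hpow hk hf0 n) ((characteristicDominated_iteratedDeriv hf hf0 le_rfl).pow hk n)

/-- The characteristic function of `f` is controlled by that of a differential monomial. -/
theorem exists_characteristic_le_characteristic_diffMonomial (hf : Meromorphic f)
    (hf0 : ∀ z, meromorphicOrderAt (iteratedDeriv k f) z ≠ ⊤)
    (hk : 1 ≤ k) (hl : 2 ≤ l) (hn : 2 ≤ n) :
    ∃ C : ℝ, 0 ≤ C ∧ ∀ r R : ℝ, 1 ≤ r → r < R → characteristic f ⊤ r ≤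
      characteristic (diffMonomial f k l n) ⊤ r + C * logDerivError f r R := by
  have hF := meromorphic_diffMonomial hf k l n
  have hord := exists_meromorphicOrderAt_diffMonomial hf hf0 hk hl hn
  set F := diffMonomial f k l n with hFdef
  have hfk := meromorphic_iteratedDeriv hf k
  have h0 : ∀ z, meromorphicOrderAt f z ≠ ⊤ := by
    simpa using fun z ↦ meromorphicOrderAt_iteratedDeriv_ne_top hf0 (Nat.zero_le k) z
  obtain ⟨C, hC, H⟩ := proximityNegligible_iteratedDeriv_div hf hf0 le_rfl
  obtain ⟨c₁, hc₁, K₁⟩ := exists_characteristic_inv_le hf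
  obtain ⟨c₂, hc₂, K₂⟩ := exists_characteristic_inv_le hF
  refine ⟨n * C + c₁ + c₂, by positivity, fun r R hr hR ↦ ?_⟩
  have heq : (f⁻¹) ^ (l + n) =ᶠ[codiscrete ℂ] F⁻¹ * (iteratedDeriv k f / f) ^ n := by
    filter_upwards [eventually_codiscrete_ne_zero hf h0, eventually_codiscrete_ne_zero hfk hf0]
      with z h1 h2
    simp only [hFdef, diffMonomial, Pi.pow_apply, Pi.inv_apply, Pi.mul_apply, Pi.div_apply]
    rw [inv_pow, div_pow, pow_add]
    field_simp
  have m1 : (l + n) * proximity f⁻¹ ⊤ r ≤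
      proximity F⁻¹ ⊤ r + n * proximity (iteratedDeriv k f / f) ⊤ r := by
    have h1 := proximity_congr_codiscrete (a := ⊤) heq (by linarith : r ≠ 0)
    have h2 := proximity_mul_top_le hF.inv (meromorphic_pow (hfk.div hf) n) r
    rw [← h1, Pi.add_apply, proximity_pow_top, proximity_pow_top] at h2
    simpa using h2
  have m2 : logCounting f 0 r ≤ logCounting F 0 r := by
    rw [logCounting_zero, logCounting_zero]
    refine Function.locallyFinsuppWithin.logCounting_le ?_ hr
    rw [Function.locallyFinsuppWithin.le_def, Pi.le_def]
    intro z
    obtain ⟨p, P, hp, hP, h⟩ := hord z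
    simp only [Function.locallyFinsuppWithin.posPart_apply, divisor_univ_apply hf,
      divisor_univ_apply hF, hp, hP, WithTop.untop₀_coe]
    simp only [posPart_def]
    omega
  have m3 : 0 ≤ proximity f⁻¹ ⊤ r := proximity_nonneg r
  have m4 : proximity f⁻¹ ⊤ r ≤ (l + n) * proximity f⁻¹ ⊤ r := by
    refine le_mul_of_one_le_left m3 ?_
    exact_mod_cast (by omega : 1 ≤ l + n)
  have m5 : (n : ℝ) * proximity (iteratedDeriv k f / f) ⊤ r ≤ n * (C * logDerivError f r R) := by
    gcongr
    exact H r R hr hR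
  have m6 := (K₁ r).2
  have m7 := (K₂ r).1
  have hE := one_le_logDerivError (f := f) hr hR
  have m8 : (c₁ + c₂) * 1 ≤ (c₁ + c₂) * logDerivError f r R := by gcongr
  -- The first main theorem passes from f and F to their inverses, where the proximity and counting
  -- parts have been compared separately.
  simp only [characteristic, Pi.add_apply, logCounting_inv] at m6 m7 ⊢
  linarith

end DiffMonomial

end ValueDistribution

/-! ### Borel's growth lemma -/

namespace ValueDistribution

open MeasureTheory Real Metric MeromorphicOn

/-- A form of **Borel's growth lemma**. -/
lemma exists_le_two_mul_of_monotoneOn {T : ℝ → ℝ} {s : ℝ} (hT : MonotoneOn T (Set.Ici s))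
    (hs : 1 ≤ T s) : ∃ r ≥ s, T (r + (T r)⁻¹) ≤ 2 * T r := by
  by_contra! h
  -- If the claim fails, each step r ↦ r + 1/T(r) doubles T, while the step lengths sum to at most
  -- 2; T would be unbounded on [s, s + 2].
  have hstep : ∀ n : ℕ, ∃ r, s ≤ r ∧ r ≤ s + 2 - 2 * (1 / 2) ^ n ∧ 2 ^ n ≤ T r := by
    intro n
    induction n with
    | zero => exact ⟨s, le_rfl, by norm_num, by simpa using hs⟩
    | succ m ih =>
      obtain ⟨r, hr1, hr2, hr3⟩ := ih
      have hpos : 0 < T r := lt_of_lt_of_le (by positivity) hr3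
      refine ⟨r + (T r)⁻¹, by have := inv_pos.2 hpos; linarith, ?_, ?_⟩
      · have : (T r)⁻¹ ≤ (1 / 2) ^ m := by
          rw [one_div, inv_pow]
          exact inv_anti₀ (by positivity) hr3
        rw [pow_succ]
        linarith
      · rw [pow_succ]
        linarith [h r hr1]
  obtain ⟨n, hn⟩ := pow_unbounded_of_one_lt (T (s + 2)) (one_lt_two (α := ℝ))
  obtain ⟨r, hr1, hr2, hr3⟩ := hstep n
  have h1 : (0 : ℝ) < (1 / 2) ^ n := by positivity
  have := hT (Set.mem_Ici.2 hr1) (Set.mem_Ici.2 (by linarith : s ≤ s + 2)) (by linarith)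
  linarith

/-- A nondecreasing function which is, up to the usual error terms, of the order of its own
logarithm grows at most logarithmically along some sequence. -/
lemma exists_frequently_le_mul_log {T : ℝ → ℝ} {C r₀ : ℝ} (hT : MonotoneOn T (Set.Ici r₀))
    (h : ∀ r R, r₀ ≤ r → r < R →
      T r ≤ C * (1 + log (1 + T R) + log (1 + (R - r)⁻¹) + log R)) (hC : 1 ≤ C) :
    ∃ C' : ℝ, ∃ᶠ r in atTop, T r ≤ C' * log r := by
  have hl : 0 ≤ log (4 * C) := log_nonneg (by linarith)
  refine ⟨2 * C * (6 + 2 * log (4 * C)) + 1, ?_⟩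
  rw [frequently_atTop]
  intro s₁
  set s := max s₁ (max r₀ 3) with hs
  have hs1 : s₁ ≤ s := le_max_left _ _
  have hs2 : r₀ ≤ s := (le_max_left _ _).trans (le_max_right _ _)
  have hs3 : 3 ≤ s := (le_max_right _ _).trans (le_max_right _ _)
  by_contra! hcon
  have hlog : ∀ r, s ≤ r → 1 ≤ log r := fun r hr ↦ by
    rw [le_log_iff_exp_le (by linarith)]
    linarith [exp_one_lt_d9]
  have hbig : ∀ r, s ≤ r → 1 ≤ T r := fun r hr ↦ by
    have h1 := hcon r (hs1.trans hr)
    have h2 := hlog r hr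
    have h3 : 0 ≤ 2 * C * (6 + 2 * log (4 * C)) * log r := by positivity
    linarith
  obtain ⟨r, hr, hr2⟩ := exists_le_two_mul_of_monotoneOn
    (hT.mono (Set.Ici_subset_Ici.2 hs2)) (hbig s le_rfl)
  have hT1 := hbig r hr
  have hinv : 0 < (T r)⁻¹ := inv_pos.2 (by linarith)
  have hinv1 : (T r)⁻¹ ≤ 1 := inv_le_one_of_one_le₀ hT1
  have hR1 := hbig (r + (T r)⁻¹) (by linarith)
  -- With R = r + 1/T(r), the term (R - r)⁻¹ equals T(r) and T(R) ≤ 2 T(r).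
  have key := h r (r + (T r)⁻¹) (hs2.trans hr) (by linarith)
  rw [add_sub_cancel_left, inv_inv] at key
  have l1 : log (1 + T (r + (T r)⁻¹)) ≤ 2 + log (T r) := by
    have h1 : log (1 + T (r + (T r)⁻¹)) ≤ log (3 * T r) := log_le_log (by linarith) (by linarith)
    rw [log_mul (by norm_num) (by linarith)] at h1
    linarith [log_le_sub_one_of_pos (x := 3) (by norm_num)]
  have l2 : log (1 + T r) ≤ 1 + log (T r) := by
    have h1 : log (1 + T r) ≤ log (2 * T r) := log_le_log (by linarith) (by linarith)
    rw [log_mul (by norm_num) (by linarith)] at h1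
    linarith [log_le_sub_one_of_pos (x := 2) (by norm_num)]
  have l3 : log (r + (T r)⁻¹) ≤ 1 + log r := by
    have h1 : log (r + (T r)⁻¹) ≤ log (2 * r) := log_le_log (by linarith) (by linarith)
    rw [log_mul (by norm_num) (by linarith)] at h1
    linarith [log_le_sub_one_of_pos (x := 2) (by norm_num)]
  -- The slope 1/(4C) makes the two logarithms of T contribute exactly T(r)/2, which is absorbed on
  -- the left.
  have l4 : log (T r) ≤ T r / (4 * C) + log (4 * C) := by
    have h1 := log_le_sub_one_of_pos (x := T r / (4 * C)) (by positivity)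
    rw [log_div (by linarith) (by linarith)] at h1
    linarith
  have l5 : T r ≤ C * (5 + 2 * (T r / (4 * C) + log (4 * C)) + log r) := by
    refine key.trans (mul_le_mul_of_nonneg_left ?_ (by linarith))
    linarith
  have l6 : C * (5 + 2 * (T r / (4 * C) + log (4 * C)) + log r) =
      T r / 2 + C * (5 + 2 * log (4 * C) + log r) := by
    field_simp
    ring
  have l7 : T r ≤ 2 * (C * (5 + 2 * log (4 * C) + log r)) := by linarith
  have hlr := hlog r hr
  have l8 : C * (5 + 2 * log (4 * C) + log r) ≤ C * ((6 + 2 * log (4 * C)) * log r) := by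
    gcongr
    nlinarith [mul_nonneg hl (by linarith : 0 ≤ log r - 1)]
  have := hcon r (hs1.trans hr)
  linarith

end ValueDistribution

/-! ### Logarithmic growth forces rationality -/

namespace ValueDistribution

open MeasureTheory Real Metric MeromorphicOn

section Rational

variable {f : ℂ → ℂ}

/-- A meromorphic function of logarithmic growth along some sequence has finitely many zeros and
poles. -/
lemma finite_support_divisor_of_frequently_le (hf : Meromorphic f) {C : ℝ}
    (h : ∃ᶠ r in atTop, characteristic f ⊤ r ≤ C * log r) :
    (divisor f Set.univ).support.Finite := by
  obtain ⟨c, hc, K⟩ := exists_characteristic_inv_le hf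
  by_contra hinf
  -- N zeros or poles give N log (R/ρ) ≤ 2 T(R) + c ≤ 2C log R + c along the sequence, which fails
  -- for large R once N ≥ 2C + 1.
  obtain ⟨N, hN⟩ := exists_nat_ge (2 * C + 1)
  obtain ⟨t, ht, htN⟩ := Set.Infinite.exists_subset_card_eq hinf N
  set ρ := 1 + ∑ u ∈ t, ‖u‖ with hρ
  have hρ1 : 1 ≤ ρ := by
    have : 0 ≤ ∑ u ∈ t, ‖u‖ := Finset.sum_nonneg fun u _ ↦ norm_nonneg u
    linarith
  have hmem : ∀ u ∈ t, ‖u‖ ≤ ρ := fun u hu ↦ by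
    have := Finset.single_le_sum (f := fun u : ℂ ↦ ‖u‖) (fun u _ ↦ norm_nonneg u) hu
    linarith
  have hS : (N : ℝ) ≤ ∑ u ∈ t, |(divisor f Set.univ u : ℝ)| := by
    rw [← htN, Finset.card_eq_sum_ones, Nat.cast_sum]
    refine Finset.sum_le_sum fun u hu ↦ ?_
    have h1 : divisor f Set.univ u ≠ 0 := ht hu
    have h2 : 1 ≤ |divisor f Set.univ u| := Int.one_le_abs h1
    exact_mod_cast h2
  have hev : ∀ᶠ R in atTop, N * log ρ + c < log R := tendsto_log_atTop.eventually_gt_atTop _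
  obtain ⟨R, hR1, hR2, hR3⟩ := (h.and_eventually (hev.and (eventually_ge_atTop ρ))).exists
  have key := sum_abs_divisor_mul_log_le (fun R ↦ (K R).1) hρ1 hR3 t hmem
  have hlog : 0 ≤ log (R / ρ) := log_nonneg ((one_le_div (by linarith)).2 hR3)
  have h1 : (N : ℝ) * log (R / ρ) ≤ (∑ u ∈ t, |(divisor f Set.univ u : ℝ)|) * log (R / ρ) := by
    gcongr
  rw [log_div (by linarith) (by linarith)] at h1 key
  have hlR : 0 ≤ log R := log_nonneg (by linarith)
  have h2 : (2 * C + 1) * log R ≤ N * log R := by gcongr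
  linarith

lemma tendsto_log_bound (A B r : ℝ) :
    Tendsto (fun ρ : ℝ ↦ 64 * ρ * (A * log ρ + B) / (ρ - r) ^ 2) atTop (𝓝 0) := by
  have h1 : Tendsto (fun ρ : ℝ ↦ log ρ / ρ) atTop (𝓝 0) :=
    isLittleO_log_id_atTop.tendsto_div_nhds_zero
  have h2 : Tendsto (fun ρ : ℝ ↦ ρ⁻¹) atTop (𝓝 0) := tendsto_inv_atTop_zero
  have h3 : Tendsto (fun ρ : ℝ ↦ 64 * (A * (log ρ / ρ) + B * ρ⁻¹) / (1 - r * ρ⁻¹) ^ 2) atTop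
      (𝓝 (64 * (A * 0 + B * 0) / (1 - r * 0) ^ 2)) := by
    refine Tendsto.div ?_ ((tendsto_const_nhds.sub (h2.const_mul r)).pow 2) (by norm_num)
    exact ((h1.const_mul A).add (h2.const_mul B)).const_mul 64
  simp only [mul_zero, add_zero, zero_div] at h3
  refine h3.congr' ?_
  filter_upwards [eventually_gt_atTop 0, eventually_gt_atTop r] with ρ hρ hr
  have h4 : 1 - r * ρ⁻¹ = (ρ - r) / ρ := by field_simp
  have h5 : ρ - r ≠ 0 := by linarith
  rw [h4]
  field_simp

lemma isRational_of_eventuallyEq_finprod {D : ℂ → ℤ} (hD : D.support.Finite) {c : ℂ}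
    (h : f =ᶠ[codiscrete ℂ] fun z ↦ (∏ u ∈ hD.toFinset, (z - u) ^ D u) * c) : IsRational f := by
  refine ⟨Polynomial.C c * ∏ u ∈ hD.toFinset, (Polynomial.X - Polynomial.C u) ^ (D u).toNat,
    ∏ u ∈ hD.toFinset, (Polynomial.X - Polynomial.C u) ^ (-D u).toNat, ?_, ?_⟩
  · exact Finset.prod_ne_zero_iff.2 fun u _ ↦ pow_ne_zero _ (Polynomial.X_sub_C_ne_zero u)
  · filter_upwards [h] with z hz
    rw [hz]
    simp only [Polynomial.eval_mul, Polynomial.eval_C, Polynomial.eval_prod, Polynomial.eval_pow,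
      Polynomial.eval_sub, Polynomial.eval_X]
    rw [mul_div_assoc, ← Finset.prod_div_distrib, mul_comm]
    congr 1
    refine Finset.prod_congr rfl fun u _ ↦ ?_
    rcases le_total 0 (D u) with h0 | h0
    · rw [Int.toNat_of_nonpos (by omega : -D u ≤ 0), pow_zero, div_one, ← zpow_natCast,
        Int.toNat_of_nonneg h0]
    · rw [Int.toNat_of_nonpos h0, pow_zero, ← zpow_natCast, Int.toNat_of_nonneg (by omega),
        zpow_neg, one_div, inv_inv]

/-- A meromorphic function whose characteristic function grows logarithmically along some sequence
is rational. -/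
theorem isRational_of_frequently_characteristic_le (hf : Meromorphic f)
    (hf0 : ∀ z, meromorphicOrderAt f z ≠ ⊤) {C : ℝ}
    (h : ∃ᶠ r in atTop, characteristic f ⊤ r ≤ C * log r) : IsRational f := by
  obtain ⟨c, hc, K⟩ := exists_characteristic_inv_le hf
  have hfin := finite_support_divisor_of_frequently_le hf h
  obtain ⟨g, hg, hg0, hfg⟩ := hf.meromorphicOn.extract_zeros_poles (fun u ↦ hf0 u) hfin
  have hg0' : ∀ z, g z ≠ 0 := fun z ↦ hg0 ⟨z, Set.mem_univ z⟩
  set n := ∑ u ∈ hfin.toFinset, |(divisor f Set.univ u : ℝ)| with hn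
  have hn0 : 0 ≤ n := Finset.sum_nonneg fun u _ ↦ abs_nonneg _
  -- A Liouville argument: the bound for the zero-free factor g is O(log ρ / ρ) along the sequence
  -- of radii, so g is constant.
  have hld : ∀ z, logDeriv g z = 0 := by
    intro z
    by_contra hz
    have hpos : 0 < ‖logDeriv g z‖ := norm_pos_iff.2 hz
    have hev := (tendsto_log_bound (2 * C + 2 * n) (c + 2 * n + 1) ‖z‖).eventually_lt_const hpos
    obtain ⟨s, hs⟩ := hfin.isBounded.subset_closedBall (0 : ℂ)
    obtain ⟨ρ, hρT, hρ1, hρ2, hρ3, hρ4⟩ := (h.and_eventually (hev.and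
      ((eventually_ge_atTop s).and ((eventually_ge_atTop 1).and (eventually_gt_atTop ‖z‖))))).exists
    refine absurd (norm_logDeriv_le_of_ne_zero (hg.mono (Set.subset_univ _))
      (fun w _ ↦ hg0' w) le_rfl hρ4) (not_le.2 (lt_of_le_of_lt ?_ hρ1))
    have h1 := circleAverage_abs_log_norm_le_of_extract hf hfin
      (hs.trans (closedBall_subset_closedBall hρ2)) hρ3 (Set.subset_univ _) hg hg0 hfg
    rw [← hn, log_mul (by norm_num) (by linarith)] at h1
    have h2 := proximity_le_characteristic (f := f) hρ3
    have h3 := proximity_le_characteristic (f := f⁻¹) hρ3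
    have h4 := (K ρ).1
    have h5 : n * (2 * (log 2 + log ρ)) ≤ n * (2 * (1 + log ρ)) := by
      gcongr
      linarith [log_two_lt_d9]
    refine div_le_div_of_nonneg_right (mul_le_mul_of_nonneg_left ?_ (by linarith)) (sq_nonneg _)
    linarith
  have hd : ∀ z, deriv g z = 0 := fun z ↦ by
    have := hld z
    rw [logDeriv_apply, div_eq_zero_iff] at this
    exact this.resolve_right (hg0' z)
  have hdiff : Differentiable ℂ g := fun z ↦ (hg z (Set.mem_univ z)).differentiableAt
  refine isRational_of_eventuallyEq_finprod hfin (c := g 0) ?_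
  filter_upwards [hfg] with z hz
  rw [hz, finprod_eq_prod_of_mulSupport_subset (s := hfin.toFinset) _
    (by simp [Function.FactorizedRational.mulSupport])]
  simp [Finset.prod_apply, is_const_of_deriv_eq_zero hdiff hd z 0]

end Rational

end ValueDistribution

/-! ### Degenerate cases and conclusion -/

namespace ValueDistribution

open MeasureTheory Real Metric MeromorphicOn

section Polynomial

variable {f : ℂ → ℂ} {k : ℕ}

lemma iteratedDeriv_congr_nhdsNE {g : ℂ → ℂ} {z : ℂ} (h : f =ᶠ[𝓝[≠] z] g) (k : ℕ) :
    iteratedDeriv k f =ᶠ[𝓝[≠] z] iteratedDeriv k g := by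
  induction k with
  | zero => simpa using h
  | succ m ih =>
    rw [iteratedDeriv_succ, iteratedDeriv_succ]
    exact ih.nhdsNE_deriv

/-- The Taylor series at 0 terminates. -/
lemma exists_polynomial_of_iteratedDeriv_eq_zero {H : ℂ → ℂ} (hH : Differentiable ℂ H)
    (h : iteratedDeriv k H = 0) : ∃ p : Polynomial ℂ, p.degree < k ∧ H = fun z ↦ p.eval z := by
  have hvan : ∀ m, k ≤ m → iteratedDeriv m H = 0 := by
    intro m hm
    induction m, hm using Nat.le_induction with
    | base => exact h
    | succ m _ ih =>
      rw [iteratedDeriv_succ, ih]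
      ext z
      simp
  refine ⟨∑ i ∈ Finset.range k, Polynomial.C ((i.factorial : ℂ)⁻¹ * iteratedDeriv i H 0) *
    Polynomial.X ^ i, ?_, ?_⟩
  · rw [Polynomial.degree_lt_iff_coeff_zero]
    intro m hm
    simp only [Polynomial.finsetSum_coeff, Polynomial.coeff_C_mul_X_pow]
    refine Finset.sum_eq_zero fun i hi ↦ if_neg ?_
    have := Finset.mem_range.1 hi
    omega
  · ext z
    rw [← Complex.taylorSeries_eq_of_entire' 0 z hH, tsum_eq_sum (s := Finset.range k)]
    · simp [Polynomial.eval_finsetSum]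
    · intro m hm
      rw [hvan m (by simpa using hm)]
      simp

/-- A meromorphic function with vanishing `k`-th derivative is a polynomial of degree less than
`k`. -/
lemma exists_polynomial_of_meromorphicOrderAt_iteratedDeriv (hf : Meromorphic f)
    (h : ∀ z, meromorphicOrderAt (iteratedDeriv k f) z = ⊤) :
    ∃ p : Polynomial ℂ, p.degree < k ∧ f =ᶠ[codiscrete ℂ] fun z ↦ p.eval z := by
  -- A pole of f would persist in the k-th derivative with finite order. So the normal form of f is
  -- entire.
  have hnn : ∀ z, 0 ≤ meromorphicOrderAt f z := by
    intro z
    by_contra! hneg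
    lift meromorphicOrderAt f z to ℤ using hneg.ne_top with p hp
    have := meromorphicOrderAt_iteratedDeriv_of_neg (by exact_mod_cast hneg) hp.symm k
    rw [h z] at this
    exact WithTop.coe_ne_top this.symm
  set H := toMeromorphicNFOn f Set.univ with hHdef
  have hH : ∀ z, AnalyticAt ℂ H z := fun z ↦ by
    rw [← (meromorphicNFOn_toMeromorphicNFOn f Set.univ
      (Set.mem_univ z)).meromorphicOrderAt_nonneg_iff_analyticAt,
      meromorphicOrderAt_toMeromorphicNFOn hf.meromorphicOn (Set.mem_univ z)]
    exact hnn z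
  have hzero : iteratedDeriv k H = 0 := by
    ext z
    have h1 : f =ᶠ[𝓝[≠] z] H :=
      (hf.meromorphicOn.toMeromorphicNFOn_eq_self_on_nhdsNE (Set.mem_univ z)).symm
    have h2 := (iteratedDeriv_congr_nhdsNE h1 k).symm.trans (meromorphicOrderAt_eq_top_iff.1 (h z))
    have h3 : AnalyticAt ℂ (iteratedDeriv k H) z := by
      rw [iteratedDeriv_eq_iterate]
      exact (hH z).iterated_deriv k
    exact ((h3.continuousAt.eventuallyEq_nhds_iff_eventuallyEq_nhdsNE
      continuousAt_const).1 h2).eq_of_nhds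
  obtain ⟨p, hp, hpH⟩ := exists_polynomial_of_iteratedDeriv_eq_zero
    (fun z ↦ (hH z).differentiableAt) hzero
  refine ⟨p, hp, ?_⟩
  rw [← hpH]
  exact toMeromorphicNFOn_eqOn_codiscrete hf.meromorphicOn

end Polynomial

section Main

variable {f : ℂ → ℂ} {k l n : ℕ}

lemma meromorphicOrderAt_eq_top_of_eq_top (hf : Meromorphic f) {z : ℂ}
    (h : meromorphicOrderAt f z = ⊤) (w : ℂ) : meromorphicOrderAt f w = ⊤ := by
  by_contra hw
  exact hf.meromorphicOn.meromorphicOrderAt_ne_top_of_isPreconnected isPreconnected_univ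
    (Set.mem_univ w) (Set.mem_univ z) hw h

/-- Borel's lemma turns a bound of T(f) by its own error term into logarithmic growth along a
sequence. -/
lemma isRational_of_eventually_characteristic_le (hf : Meromorphic f)
    (hf0 : ∀ z, meromorphicOrderAt f z ≠ ⊤) {C r₀ : ℝ}
    (h : ∀ r R : ℝ, r₀ ≤ r → r < R → characteristic f ⊤ r ≤ C * logDerivError f r R) :
    IsRational f := by
  obtain ⟨C', H⟩ := exists_frequently_le_mul_log (T := characteristic f ⊤) (C := max C 1)
    (r₀ := max r₀ 1)
    (fun r hr R hR hrR ↦ characteristic_mono hf ((le_max_right _ _).trans hr) hrR)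
    (fun r R hr hrR ↦ (h r R ((le_max_left _ _).trans hr) hrR).trans
      (mul_le_mul_of_nonneg_right (le_max_left _ _)
        (zero_le_one.trans (one_le_logDerivError ((le_max_right _ _).trans hr) hrR))))
    (le_max_right _ _)
  exact isRational_of_frequently_characteristic_le hf hf0 H

lemma isPointOf_of_meromorphicOrderAt_pos {F : ℂ → ℂ} {a z : ℂ}
    (h : 0 < meromorphicOrderAt (fun w ↦ F w - a) z) : IsPointOf F (a : OnePoint ℂ) z := by
  have h1 : Tendsto (fun w ↦ F w - a) (𝓝[≠] z) (𝓝 0) :=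
    tendsto_zero_of_meromorphicOrderAt_pos h
  have h2 : Tendsto F (𝓝[≠] z) (𝓝 a) := by simpa using h1.add_const a
  exact (OnePoint.continuous_coe.tendsto a).comp h2

/-- If a differential monomial `F` of `f` has constant value then `f` is rational. -/
lemma isRational_of_meromorphicOrderAt_deriv_diffMonomial (hf : Meromorphic f)
    (hf0 : ∀ z, meromorphicOrderAt (iteratedDeriv k f) z ≠ ⊤)
    (hk : 1 ≤ k) (hl : 2 ≤ l) (hn : 2 ≤ n)
    (h : ∀ z, meromorphicOrderAt (deriv (diffMonomial f k l n)) z = ⊤) : IsRational f := by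
  have h0 : ∀ z, meromorphicOrderAt f z ≠ ⊤ := by
    simpa using fun z ↦ meromorphicOrderAt_iteratedDeriv_ne_top hf0 (Nat.zero_le k) z
  obtain ⟨p, hp, hpF⟩ := exists_polynomial_of_meromorphicOrderAt_iteratedDeriv (k := 1)
    (meromorphic_diffMonomial hf k l n) (by simpa using h)
  obtain ⟨c, rfl⟩ : ∃ c, p = Polynomial.C c :=
    ⟨_, Polynomial.eq_C_of_degree_le_zero (Nat.WithBot.lt_one_iff_le_zero.1 hp)⟩
  obtain ⟨C, hC, H⟩ := exists_characteristic_le_characteristic_diffMonomial hf hf0 hk hl hn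
  refine isRational_of_eventually_characteristic_le (C := log⁺ ‖c‖ + C) (r₀ := 1) hf h0
    fun r R hr hR ↦ (H r R hr hR).trans ?_
  simp only [Polynomial.eval_C] at hpF
  rw [characteristic_congr_codiscrete hpF (by linarith), add_mul]
  simp only [characteristic, Pi.add_apply, proximity_const, logCounting_const, Pi.zero_apply,
    add_zero]
  gcongr
  exact le_mul_of_one_le_right posLog_nonneg (one_le_logDerivError hr hR)

/-- If a differential monomial takes a nonzero value only finitely often, then `f` is rational. -/
theorem isRational_of_finite_isPointOf_diffMonomial (hf : Meromorphic f)
    (hk : 1 ≤ k) (hl : 2 ≤ l) (hn : 2 ≤ n) {a : ℂ} (ha : a ≠ 0)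
    (h : {z | IsPointOf (diffMonomial f k l n) (a : OnePoint ℂ) z}.Finite) : IsRational f := by
  -- By the identity theorem, vanishing near one point means vanishing identically: here f is then a
  -- polynomial; in the next case split F is constant.
  by_cases hf0 : ∃ z, meromorphicOrderAt (iteratedDeriv k f) z = ⊤
  · obtain ⟨z, hz⟩ := hf0
    obtain ⟨p, -, hp⟩ := exists_polynomial_of_meromorphicOrderAt_iteratedDeriv hf
      (meromorphicOrderAt_eq_top_of_eq_top (meromorphic_iteratedDeriv hf k) hz)
    exact ⟨p, 1, one_ne_zero, by simpa using hp⟩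
  push Not at hf0
  have h0 : ∀ z, meromorphicOrderAt f z ≠ ⊤ := by
    simpa using fun z ↦ meromorphicOrderAt_iteratedDeriv_ne_top hf0 (Nat.zero_le k) z
  have hF := meromorphic_diffMonomial hf k l n
  by_cases hF' : ∃ z, meromorphicOrderAt (deriv (diffMonomial f k l n)) z = ⊤
  · obtain ⟨z, hz⟩ := hF'
    exact isRational_of_meromorphicOrderAt_deriv_diffMonomial hf hf0 hk hl hn
      (meromorphicOrderAt_eq_top_of_eq_top hF.deriv hz)
  push Not at hF'
  have hord := exists_meromorphicOrderAt_diffMonomial hf hf0 hk hl hn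
  have hdom := characteristicDominated_diffMonomial hf hf0 l n
  obtain ⟨C₁, hC₁, H₁⟩ := exists_characteristic_le_characteristic_diffMonomial hf hf0 hk hl hn
  set F := diffMonomial f k l n with hFdef
  have hG : Meromorphic (fun w ↦ F w - a) := hF.sub (Meromorphic.const a)
  have hG0 : ∀ z, meromorphicOrderAt (fun w ↦ F w - a) z ≠ ⊤ := fun z hz ↦ hF' z (by
    simpa using meromorphicOrderAt_deriv_eq_top hz)
  obtain ⟨C₂, hC₂, H₂⟩ := exists_characteristic_le_logCounting hF ha
    (fun z ↦ by obtain ⟨p, P, -, hP, -⟩ := hord z; rw [hP]; exact WithTop.coe_ne_top) hG0 hF'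
    (fun z hz ↦ by
      obtain ⟨p, P, -, hP, hh⟩ := hord z
      rw [hP] at hz ⊢
      norm_cast at hz ⊢
      omega)
    (fun z hz ↦ by
      obtain ⟨p, P, -, hP, hh⟩ := hord z
      rw [hP] at hz ⊢
      norm_cast at hz ⊢
      omega) hdom
  -- The zeros of F - a are a-points of F, so their counting function is O(log r), which the term
  -- log R of the error absorbs.
  have hfin : ((divisor (fun w ↦ F w - a) Set.univ)⁺).support.Finite := by
    refine h.subset fun z hz ↦ isPointOf_of_meromorphicOrderAt_pos ?_
    by_contra! hle
    apply hz
    rw [Function.locallyFinsuppWithin.posPart_apply, divisor_univ_apply hG, posPart_eq_zero]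
    lift meromorphicOrderAt (fun w ↦ F w - a) z to ℤ using hG0 z with q
    exact_mod_cast hle
  obtain ⟨C₃, hC₃, H₃⟩ :=
    (Function.locallyFinsuppWithin.logCounting_isBigO_log_of_finite_support hfin).exists_pos
  obtain ⟨r₀, hr₀⟩ := eventually_atTop.1 H₃.bound
  refine isRational_of_eventually_characteristic_le (C := C₁ + C₂ + 6 * C₃) (r₀ := max r₀ 1) hf h0
    fun r R hr hR ↦ ?_
  have hr1 : 1 ≤ r := (le_max_right _ _).trans hr
  have m1 := H₁ r R hr1 hR
  have m2 := H₂ r R hr1 hR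
  have m3 := (le_norm_self _).trans (hr₀ r ((le_max_left _ _).trans hr))
  rw [← logCounting_zero, norm_of_nonneg (log_nonneg hr1)] at m3
  have m4 : C₃ * log r ≤ C₃ * logDerivError f r R := by
    gcongr
    have h1 : log r ≤ log R := log_le_log (by linarith) hR.le
    have h2 := log_one_add_inv_sub_nonneg hR
    have h3 : 0 ≤ characteristic f ⊤ R := characteristic_nonneg (by linarith)
    have h4 := log_nonneg (by linarith : 1 ≤ 1 + characteristic f ⊤ R)
    unfold logDerivError
    linarith
  linarith

end Main

end ValueDistribution

theorem mainTheorem3 (f : ℂ → ℂ) (hf : ValueDistribution.IsTranscendentalMeromorphic f)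
    (k l n : ℕ) (hk : 2 ≤ k) (hl : 2 ≤ l) (hn : 2 ≤ n) :
    (∀ a : ℂ, a ≠ 0 → ValueDistribution.AssumesInfinitelyOften
      (ValueDistribution.diffMonomial f k l n) (a : OnePoint ℂ)) ∧
    (∀ a : ℂ, ValueDistribution.IsPicardExceptionalValue
      (ValueDistribution.diffMonomial f k l n) (a : OnePoint ℂ) → a = 0) := by
  have key : ∀ a : ℂ, ValueDistribution.IsPicardExceptionalValue
      (ValueDistribution.diffMonomial f k l n) (a : OnePoint ℂ) → a = 0 := by
    intro a h
    by_contra ha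
    exact hf.not_isRational (ValueDistribution.isRational_of_finite_isPointOf_diffMonomial
      hf.meromorphic (by omega) hl hn ha h)
  exact ⟨fun a ha h ↦ ha (key a h), key⟩
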